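/- Let $p\ge 2$ be an integer and $Q(x_1,x_2)=3x_1^2+3x_1x_2+x_2^2$. Let $\mathscr S$ be the family of six pairs $(1-\tfrac1p,\tfrac2p)$, $(\tfrac1p,1-\tfrac2p)$, $(1,\tfrac1p)$, $(0,1-\tfrac1p)$, $(\tfrac1p,1-\tfrac1p)$, $(1-\tfrac1p,\tfrac1p)$ (counted with multiplicity if $p=2$), let $\mathscr S^*$ consist of $(1-\tfrac1p,\tfrac2p)$, $(0,1-\tfrac1p)$, $(\tfrac1p,1-\tfrac1p)$, and put $\varepsilon(\boldsymbol\alpha)=-2$ for $\boldsymbol\alpha\in\{(1-\tfrac1p,\tfrac2p),(\tfrac1p,1-\tfrac2p)\}$ and $\varepsilon(\boldsymbol\alpha)=1$ for the other pairs. For $\operatorname{Im}\tau>0$ and $q=e^{2\pi i\tau}$ (with $q^x:=e^{2\pi i\tau x}$ for real $x$) let $$F_1(q)=\sum_{\boldsymbol\alpha\in\mathscr S}\varepsilon(\boldsymbol\alpha)\sum_{\boldsymbol n\in\boldsymbol\alpha+\mathbb N_0^2}q^{Q(\boldsymbol n)}+\frac12\sum_{m\in\mathbb Z}\operatorname{sgn}\Big(m+\frac1p\Big)q^{(m+\frac1p)^2}.$$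 Further let $$\mathbb E_1(\tau)=-\frac{\sqrt3}{4}\sum_{\boldsymbol\alpha\in\mathscr S^*}\varepsilon(\boldsymbol\alpha)\int_{-\overline\tau}^{i\infty}\int_{w_1}^{i\infty}\frac{\theta_1(\boldsymbol\alpha;w_1,w_2)+\theta_2(\boldsymbol\alpha;w_1,w_2)}{\sqrt{-i(w_1+\tau)}\,\sqrt{-i(w_2+\tau)}}\,dw_2\,dw_1,$$ where the integrals are taken along vertical rays, the square roots are principal, and $$\theta_1(\boldsymbol\alpha;w_1,w_2)=\sum_{\boldsymbol n\in\boldsymbol\alpha+\mathbb Z^2}(2n_1+n_2)\,n_2\,e^{\frac{3\pi i}{2}(2n_1+n_2)^2w_1+\frac{\pi i}{2}n_2^2w_2},$$ $$\theta_2(\boldsymbol\alpha;w_1,w_2)=\sum_{\boldsymbol n\in\boldsymbol\alpha+\mathbb Z^2}(3n_1+2n_2)\,n_1\,e^{\frac{\pi i}{2}(3n_1+2n_2)^2w_1+\frac{3\pi i}{2}n_1^2w_2}.$$ Write $f(t)\sim\sum_{m\ge0}c(m)t^m$ as $t\to0^+$ if $f(t)-\sum_{m<N}c(m)t^m=O(t^N)$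 for every $N\ge 0$. Then there are complex numbers $a_{h,k}(m)$ such that, for all $h,k\in\mathbb Z$ with $k>0$ and $\gcd(h,k)=1$, $$F_1\big(e^{2\pi i\frac hk-t}\big)\sim\sum_{m\ge0}a_{h,k}(m)\,t^m\qquad\text{and}\qquad \mathbb E_1\Big(\frac hk+\frac{it}{2\pi}\Big)\sim\sum_{m\ge0}a_{-h,k}(m)\,(-t)^m\qquad(t\to0^+),$$ where the powers of $e^{2\pi i\frac hk-t}$ in $F_1$ are those belonging to $\tau=\frac hk+\frac{it}{2\pi}$. -/

import Mathlib

namespace RankTwoFalseTheta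

noncomputable section

/-- `q ^ x` for `q = e ^ (2 π i τ)` and a real exponent `x`, that is `e ^ (2 π i τ x)`. -/
def qpow (τ : ℂ) (x : ℝ) : ℂ :=
  Complex.exp (2 * Real.pi * Complex.I * τ * x)

/-- The binary quadratic form `3 x₁² + 3 x₁ x₂ + x₂²`. -/
def Q (x y : ℝ) : ℝ := 3 * x ^ 2 + 3 * x * y + y ^ 2

/-- The six shifts `𝒮`, as a family. (For `p = 2` the last two shifts are both `(1/2, 1/2)` and
both of them count.) -/
def shift (p : ℕ) : Fin 6 → ℝ × ℝ :=
  ![(1 - 1 / (p : ℝ), 2 / (p : ℝ)), (1 / (p : ℝ), 1 - 2 / (p : ℝ)),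
    (1, 1 / (p : ℝ)), (0, 1 - 1 / (p : ℝ)),
    (1 / (p : ℝ), 1 - 1 / (p : ℝ)), (1 - 1 / (p : ℝ), 1 / (p : ℝ))]

/-- The weights `ε(α)` of the six shifts, in the same order. -/
def shiftWeight : Fin 6 → ℂ := ![-2, -2, 1, 1, 1, 1]

/-- The three shifts `𝒮*`. -/
def shiftStar (p : ℕ) : Fin 3 → ℝ × ℝ :=
  ![(1 - 1 / (p : ℝ), 2 / (p : ℝ)), (0, 1 - 1 / (p : ℝ)), (1 / (p : ℝ), 1 - 1 / (p : ℝ))]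

/-- The weights `ε(α)` of the three shifts in `𝒮*`, in the same order. -/
def shiftStarWeight : Fin 3 → ℂ := ![-2, 1, 1]

/-- The function `F₁(q)`, `q = e ^ (2 π i τ)`, as a function of `τ` in the upper half-plane
(the exponents of `q` are rational, so that `τ` fixes the branch of the powers of `q`). -/
def F1 (p : ℕ) (τ : ℂ) : ℂ :=
  ∑ j : Fin 6, shiftWeight j *
      ∑' n : ℕ × ℕ, qpow τ (Q ((shift p j).1 + n.1) ((shift p j).2 + n.2)) +
    1 / 2 * ∑' m : ℤ, (Real.sign (m + 1 / (p : ℝ)) : ℂ) * qpow τ ((m + 1 / (p : ℝ)) ^ 2)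

/-- `∫_z^{i∞} g(w) dw`, along the vertical ray `w = z + i s`, `s > 0`. -/
def rayIntegral (g : ℂ → ℂ) (z : ℂ) : ℂ :=
  ∫ s in Set.Ioi (0 : ℝ), g (z + s * Complex.I) * Complex.I

/-- `θ₁(α; w) = ∑ (2 n₁ + n₂) n₂ e ^ (3πi/2 (2 n₁ + n₂)² w₁ + πi/2 n₂² w₂)`, the sum being over
`n ∈ α + ℤ²`. -/
def theta1 (α : ℝ × ℝ) (w₁ w₂ : ℂ) : ℂ :=
  ∑' n : ℤ × ℤ,
    let n₁ : ℝ := α.1 + n.1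
    let n₂ : ℝ := α.2 + n.2
    (((2 * n₁ + n₂) * n₂ : ℝ) : ℂ) *
      Complex.exp (3 * Real.pi * Complex.I / 2 * (((2 * n₁ + n₂) ^ 2 : ℝ) : ℂ) * w₁ +
        Real.pi * Complex.I / 2 * ((n₂ ^ 2 : ℝ) : ℂ) * w₂)

/-- `θ₂(α; w) = ∑ (3 n₁ + 2 n₂) n₁ e ^ (πi/2 (3 n₁ + 2 n₂)² w₁ + 3πi/2 n₁² w₂)`, the sum being over
`n ∈ α + ℤ²`. -/
def theta2 (α : ℝ × ℝ) (w₁ w₂ : ℂ) : ℂ :=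
  ∑' n : ℤ × ℤ,
    let n₁ : ℝ := α.1 + n.1
    let n₂ : ℝ := α.2 + n.2
    (((3 * n₁ + 2 * n₂) * n₁ : ℝ) : ℂ) *
      Complex.exp (Real.pi * Complex.I / 2 * (((3 * n₁ + 2 * n₂) ^ 2 : ℝ) : ℂ) * w₁ +
        3 * Real.pi * Complex.I / 2 * ((n₁ ^ 2 : ℝ) : ℂ) * w₂)

/-- The principal square root of `-i (w + τ)`. -/
def rootFactor (τ w : ℂ) : ℂ := (-Complex.I * (w + τ)) ^ (1 / 2 : ℂ)

/-- The double Eichler integral `𝓔_{1,α}(τ)`. -/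
def calE1Shift (α : ℝ × ℝ) (τ : ℂ) : ℂ :=
  -((Real.sqrt 3 : ℝ) : ℂ) / 4 *
    rayIntegral (fun w₁ =>
      rayIntegral (fun w₂ =>
        (theta1 α w₁ w₂ + theta2 α w₁ w₂) / (rootFactor τ w₁ * rootFactor τ w₂)) w₁)
      (-(starRingEnd ℂ) τ)

/-- `𝓔₁(τ) = ∑_{α ∈ 𝒮*} ε(α) 𝓔_{1,α}(p τ)`. -/
def calE1 (p : ℕ) (τ : ℂ) : ℂ :=
  ∑ j : Fin 3, shiftStarWeight j * calE1Shift (shiftStar p j) (p * τ)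

/-- `𝔼₁(τ) = 𝓔₁(τ / p)`. -/
def bbE1 (p : ℕ) (τ : ℂ) : ℂ := calE1 p (τ / p)

/-- `f(t) ∼ ∑_{m ≥ 0} a(m) t ^ m` as `t → 0⁺`: for every `N`, the difference of `f` and the sum
over `m < N` is `O(t ^ N)`. -/
def HasAsympExpansion (f : ℝ → ℂ) (a : ℕ → ℂ) : Prop :=
  ∀ N : ℕ, Asymptotics.IsBigO (nhdsWithin 0 (Set.Ioi 0))
    (fun t : ℝ => f t - ∑ m ∈ Finset.range N, a m * (t : ℂ) ^ m) (fun t : ℝ => t ^ N)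

/-- The point `h / k + i t / (2 π)`, for which `e ^ (2 π i τ) = e ^ (2 π i h / k - t)`. -/
def nearRational (h k : ℤ) (t : ℝ) : ℂ :=
  (h : ℂ) / (k : ℂ) + Complex.I * t / (2 * Real.pi)

end

end RankTwoFalseTheta

/-!
Both functions are values of one double Eichler integral, at opposite arguments. For a function
`G` of `0 < y₁ < y₂` put
`J(s) = ∫ G(y₁, y₂) ((y₁ - s) (y₂ - s)) ^ (-1/2)` over `|s| < y₁ < y₂` (`eichlerIntegral`).
If `G` is flat, that is, vanishes to infinite order as `y₁ → 0` and decays exponentially in `y₂`,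
then expanding the kernel in powers of `s` shows that `J` has an asymptotic expansion in powers of
`s` which is the same for both signs of `s` (`IsFlat.norm_eichlerIntegral_sub_le`).

Let `G_x` be the restriction of the combination of the theta series `θ₁ + θ₂` to the points
`(x + i y₁, x + i y₂)`, and let `τ = x + i ε` with `x = h / k` and `ε = t / (2 π)`. Up to the same
constant factor, `𝔼₁(τ)` is `J(-ε)` for `G_{-x}` by mere substitution (`bbE1_nearRational`), and
`F₁(τ)` is `J(ε)` for `G_x` (`F1_nearRational`). Hence the coefficients at `-h` and the sign
`(-1) ^ m`.

* Flatness for rational `x`: in the inner summation the phases are periodic, so the inner sum is a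
  finite combination of the odd theta kernels `∑ (n + a) e ^ (-π (n + a)² y)`, which the functional
  equation shows to be `O(y ^ N)` for all `N`, uniformly in `a` (`norm_tsum_periodic_mul_exp_le`).
* `F₁` as an Eichler integral: in coordinates with `A² + B² = 4 Q`, integrating
  `A B e ^ (-π (A² y₁ + B² y₂) / 2)` against the kernel at `s = ε` gives
  `(4 / π) arctan (A / B) e ^ (-2 π ε Q)` (`integral_oddGaussian_mul_eichlerKernel`). The angles
  `arctan (A / B)` belonging to `θ₁` and `θ₂` add up to `π / 3 + (π / 2) sgn n₁ sgn n₂`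
  (`arctan_add_arctan_eq`). On the other side, `F₁` is half the weighted sum of
  `∑ sgn n₁ sgn n₂ q ^ Q(n)` over the three cosets (`F1_eq_sum_falseTheta`). The constant angle and
  the constant part of the quadrant sums contribute multiples of `∑ ε(α) ∑ q ^ Q(n)`, which is zero:
  automorphisms of `Q` permute the three cosets up to sign, and the weights are `-2, 1, 1`.
-/

namespace RankTwoFalseTheta

open MeasureTheory Set Filter

/-! ### Taylor expansion of the kernel -/

/-- The Taylor coefficients of `(1 - r) ^ (-1/2)` at `r = 0`. -/
noncomputable def invSqrtCoeff (i : ℕ) : ℝ := Ring.choose ((1 / 2 : ℝ) + i - 1) i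

lemma invSqrt_sub_taylor_le (N : ℕ) : ∃ C : ℝ, 0 ≤ C ∧ ∀ r : ℝ, |r| ≤ 1 / 2 →
    |1 / √(1 - r) - ∑ i ∈ Finset.range N, invSqrtCoeff i * r ^ i| ≤ C * |r| ^ N := by
  have h := Real.one_div_one_sub_rpow_hasFPowerSeriesOnBall_zero (1 / 2)
  obtain ⟨a, ha, C, hC, H⟩ := h.uniform_geometric_approx' (r' := 3 / 4) (by
    rw [← ENNReal.coe_one, ENNReal.coe_lt_coe, ← NNReal.coe_lt_coe]; norm_num)
  refine ⟨C * (a * (4 / 3)) ^ N, by have := ha.1; positivity, fun r hr => ?_⟩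
  have := H r (by
    simp only [Metric.mem_ball, dist_zero_right, Real.norm_eq_abs]
    push_cast
    linarith) N
  rw [zero_add, ← Real.sqrt_eq_rpow, Real.norm_eq_abs] at this
  refine le_trans (le_of_eq ?_) (this.trans (le_of_eq ?_))
  · congr 2
    simp only [FormalMultilinearSeries.partialSum]
    refine Finset.sum_congr rfl fun i _ => ?_
    simp [invSqrtCoeff, mul_comm]
  · rw [Real.norm_eq_abs, mul_assoc, ← mul_pow]
    push_cast
    ring_nf

/-- The two-variable Taylor expansion of `((1 - r₁) (1 - r₂)) ^ (-1/2)`, by total degree. -/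
lemma invSqrt_mul_invSqrt_sub_taylor_le (N : ℕ) : ∃ C : ℝ, 0 ≤ C ∧ ∀ r₁ r₂ : ℝ,
    |r₁| ≤ 1 / 2 → |r₂| ≤ |r₁| →
    |1 / √(1 - r₁) * (1 / √(1 - r₂)) - ∑ m ∈ Finset.range N, ∑ k ∈ Finset.range (m + 1),
      invSqrtCoeff k * r₁ ^ k * (invSqrtCoeff (m - k) * r₂ ^ (m - k))| ≤ C * |r₁| ^ N := by
  choose C hC0 hC using invSqrt_sub_taylor_le
  refine ⟨C N * C 0 + ∑ i ∈ Finset.range N, |invSqrtCoeff i| * C (N - i), ?_, fun r₁ r₂ h₁ h₂ => ?_⟩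
  · have := hC0 N
    have := hC0 0
    have : 0 ≤ ∑ i ∈ Finset.range N, |invSqrtCoeff i| * C (N - i) :=
      Finset.sum_nonneg fun i _ => mul_nonneg (abs_nonneg _) (hC0 _)
    positivity
  rw [Finset.sum_range_diag_flip N
    (fun i j => invSqrtCoeff i * r₁ ^ i * (invSqrtCoeff j * r₂ ^ j))]
  have key : 1 / √(1 - r₁) * (1 / √(1 - r₂)) - ∑ i ∈ Finset.range N, ∑ j ∈ Finset.range (N - i),
      invSqrtCoeff i * r₁ ^ i * (invSqrtCoeff j * r₂ ^ j) =
      (1 / √(1 - r₁) - ∑ i ∈ Finset.range N, invSqrtCoeff i * r₁ ^ i) * (1 / √(1 - r₂)) +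
      ∑ i ∈ Finset.range N, invSqrtCoeff i * r₁ ^ i *
        (1 / √(1 - r₂) - ∑ j ∈ Finset.range (N - i), invSqrtCoeff j * r₂ ^ j) := by
    simp_rw [mul_sub, Finset.sum_sub_distrib, ← Finset.sum_mul, ← Finset.mul_sum]
    ring
  rw [key, add_mul]
  refine (abs_add_le _ _).trans (add_le_add ?_ ?_)
  · rw [abs_mul]
    have h3 := hC 0 r₂ (h₂.trans h₁)
    simp only [Finset.range_zero, Finset.sum_empty, sub_zero, pow_zero, mul_one] at h3
    calc _ ≤ (C N * |r₁| ^ N) * C 0 := mul_le_mul (hC N r₁ h₁) h3 (abs_nonneg _)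
          (mul_nonneg (hC0 _) (by positivity))
      _ = _ := by ring
  · rw [Finset.sum_mul]
    refine (Finset.abs_sum_le_sum_abs _ _).trans (Finset.sum_le_sum fun i hi => ?_)
    rw [abs_mul, abs_mul, abs_pow]
    have hi' : i + (N - i) = N := by have := Finset.mem_range.1 hi; omega
    calc |invSqrtCoeff i| * |r₁| ^ i * |1 / √(1 - r₂) - ∑ j ∈ Finset.range (N - i), invSqrtCoeff j * r₂ ^ j|
        ≤ |invSqrtCoeff i| * |r₁| ^ i * (C (N - i) * |r₁| ^ (N - i)) := by
          refine mul_le_mul_of_nonneg_left ((hC _ _ (h₂.trans h₁)).trans ?_) (by positivity)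
          exact mul_le_mul_of_nonneg_left (pow_le_pow_left₀ (abs_nonneg _) h₂ _) (hC0 _)
      _ = |invSqrtCoeff i| * C (N - i) * (|r₁| ^ i * |r₁| ^ (N - i)) := by ring
      _ = _ := by rw [← pow_add, hi']

/-- The kernel `((y₁ - s) (y₂ - s)) ^ (-1/2)`, cut off to `|s| < y₁`. -/
noncomputable def eichlerKernel (s y₁ y₂ : ℝ) : ℝ :=
  if |s| < y₁ then 1 / √(y₁ - s) * (1 / √(y₂ - s)) else 0

/-- The coefficient of `s ^ m` in the Taylor expansion of `eichlerKernel` at `s = 0`. -/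
noncomputable def eichlerKernelCoeff (m : ℕ) (y₁ y₂ : ℝ) : ℝ :=
  1 / √y₁ * (1 / √y₂) *
    ∑ k ∈ Finset.range (m + 1), invSqrtCoeff k / y₁ ^ k * (invSqrtCoeff (m - k) / y₂ ^ (m - k))

lemma one_div_sqrt_sub {y s : ℝ} (hy : 0 < y) :
    1 / √(y - s) = 1 / √y * (1 / √(1 - s / y)) := by
  rw [div_mul_div_comm, one_mul, ← Real.sqrt_mul hy.le]
  congr 2
  field_simp

lemma abs_eichlerKernelCoeff_le (m : ℕ) : ∃ C : ℝ, 0 ≤ C ∧ ∀ y₁ y₂ : ℝ, 0 < y₁ → y₁ < y₂ →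
    |eichlerKernelCoeff m y₁ y₂| ≤ C / y₁ ^ m * (1 / y₁) := by
  refine ⟨∑ k ∈ Finset.range (m + 1), |invSqrtCoeff k| * |invSqrtCoeff (m - k)|,
    Finset.sum_nonneg fun _ _ => by positivity, fun y₁ y₂ h₁ h₂ => ?_⟩
  have h₃ : 0 < y₂ := h₁.trans h₂
  rw [eichlerKernelCoeff, abs_mul, mul_comm]
  refine mul_le_mul ?_ ?_ (abs_nonneg _) (by
    have : 0 ≤ ∑ k ∈ Finset.range (m + 1), |invSqrtCoeff k| * |invSqrtCoeff (m - k)| :=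
      Finset.sum_nonneg fun _ _ => by positivity
    positivity)
  · rw [Finset.sum_div]
    refine (Finset.abs_sum_le_sum_abs _ _).trans (Finset.sum_le_sum fun k hk => ?_)
    have hk' : k + (m - k) = m := by have := Finset.mem_range.1 hk; omega
    rw [abs_mul, abs_div, abs_div, abs_pow, abs_pow, abs_of_pos h₁, abs_of_pos h₃, div_mul_div_comm]
    refine div_le_div_of_nonneg_left (by positivity) (by positivity) ?_
    calc y₁ ^ m = y₁ ^ k * y₁ ^ (m - k) := by rw [← pow_add, hk']
      _ ≤ _ := by gcongr
  · rw [abs_of_nonneg (by positivity), div_mul_div_comm, one_mul]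
    refine div_le_div_of_nonneg_left (by positivity) (by positivity) ?_
    calc y₁ = √y₁ * √y₁ := (Real.mul_self_sqrt h₁.le).symm
      _ ≤ _ := by gcongr

lemma abs_eichlerKernel_le {s y₁ y₂ : ℝ} (h₂ : y₁ < y₂) :
    |eichlerKernel s y₁ y₂| ≤
      (if |s| < y₁ then 1 / √(y₁ - |s|) * (1 / √(y₂ - y₁)) else 0) := by
  rw [eichlerKernel]
  split_ifs with h
  · rw [abs_of_nonneg (by positivity)]
    have h1 := le_abs_self s
    refine mul_le_mul (one_div_le_one_div_of_le (Real.sqrt_pos.2 (by linarith))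
      (Real.sqrt_le_sqrt (by linarith))) (one_div_le_one_div_of_le (Real.sqrt_pos.2 (by linarith))
      (Real.sqrt_le_sqrt (by linarith))) (by positivity) (by positivity)
  · simp

/-- The remainder of the expansion of `eichlerKernel` in powers of `s`, uniformly in all `s`: close
to and beyond the singularity `|s| = y₁` the factor `(|s| / y₁) ^ N` is bounded below. -/
lemma abs_eichlerKernel_sub_le (N : ℕ) : ∃ C : ℝ, 0 ≤ C ∧ ∀ s y₁ y₂ : ℝ, 0 < y₁ → y₁ < y₂ →
    |eichlerKernel s y₁ y₂ - ∑ m ∈ Finset.range N, eichlerKernelCoeff m y₁ y₂ * s ^ m| ≤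
      C * |s| ^ N / y₁ ^ N *
        (1 / y₁ + if |s| < y₁ then 1 / √(y₁ - |s|) * (1 / √(y₂ - y₁)) else 0) := by
  obtain ⟨C, hC0, hC⟩ := invSqrt_mul_invSqrt_sub_taylor_le N
  choose D hD0 hD using abs_eichlerKernelCoeff_le
  refine ⟨C + 2 ^ N + ∑ m ∈ Finset.range N, D m * 2 ^ N, ?_, fun s y₁ y₂ h₁ h₂ => ?_⟩
  · have : 0 ≤ ∑ m ∈ Finset.range N, D m * 2 ^ N :=
      Finset.sum_nonneg fun i _ => mul_nonneg (hD0 _) (by positivity)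
    positivity
  have hS0 : 0 ≤ ∑ m ∈ Finset.range N, D m * 2 ^ N :=
      Finset.sum_nonneg fun i _ => mul_nonneg (hD0 _) (by positivity)
  have h₃ : 0 < y₂ := h₁.trans h₂
  have hK := abs_eichlerKernel_le (s := s) h₂
  set W : ℝ := if |s| < y₁ then 1 / √(y₁ - |s|) * (1 / √(y₂ - y₁)) else 0 with hW
  have hW0 : 0 ≤ W := (abs_nonneg _).trans hK
  set q : ℝ := |s| / y₁ with hq
  have hq0 : 0 ≤ q := by positivity
  have hqs : ∀ m, |s| ^ m / y₁ ^ m = q ^ m := fun m => by rw [hq, div_pow]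
  rw [mul_div_assoc, hqs]
  have hy1 : 0 < 1 / y₁ := by positivity
  -- Taylor's formula applies for `|s| ≤ y₁ / 2`; otherwise each term is bounded separately.
  rcases le_or_gt q (1 / 2) with h | h
  · have hlt : |s| < y₁ := by
      rw [hq, div_le_iff₀ h₁] at h; linarith
    have hr1 : |s / y₁| = q := by rw [abs_div, abs_of_pos h₁]
    have hr2 : |s / y₂| ≤ q := by
      rw [abs_div, abs_of_pos h₃]
      exact div_le_div_of_nonneg_left (abs_nonneg s) h₁ h₂.le
    have e : eichlerKernel s y₁ y₂ - ∑ m ∈ Finset.range N, eichlerKernelCoeff m y₁ y₂ * s ^ m =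
        1 / √y₁ * (1 / √y₂) * (1 / √(1 - s / y₁) * (1 / √(1 - s / y₂)) -
        ∑ m ∈ Finset.range N, ∑ k ∈ Finset.range (m + 1),
      invSqrtCoeff k * (s / y₁) ^ k * (invSqrtCoeff (m - k) * (s / y₂) ^ (m - k))) := by
      rw [eichlerKernel, if_pos hlt, one_div_sqrt_sub h₁, one_div_sqrt_sub h₃, mul_sub]
      congr 1
      · ring
      · rw [Finset.mul_sum]
        refine Finset.sum_congr rfl fun m _ => ?_
        rw [eichlerKernelCoeff, mul_assoc, Finset.sum_mul]
        congr 1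
        refine Finset.sum_congr rfl fun k hk => ?_
        have hk' : k + (m - k) = m := by have := Finset.mem_range.1 hk; omega
        rw [div_pow, div_pow]
        calc _ = invSqrtCoeff k / y₁ ^ k * (invSqrtCoeff (m - k) / y₂ ^ (m - k)) *
              (s ^ k * s ^ (m - k)) := by rw [← pow_add, hk']
          _ = _ := by ring
    rw [e, abs_mul]
    have hle : |1 / √y₁ * (1 / √y₂)| ≤ 1 / y₁ := by
      rw [abs_of_nonneg (by positivity), div_mul_div_comm, one_mul]
      refine div_le_div_of_nonneg_left (by positivity) (by positivity) ?_
      calc y₁ = √y₁ * √y₁ := (Real.mul_self_sqrt h₁.le).symm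
        _ ≤ _ := by gcongr
    have := hC (s / y₁) (s / y₂) (by rw [hr1]; exact h) (by rw [hr1]; exact hr2)
    rw [hr1] at this
    calc _ ≤ 1 / y₁ * (C * q ^ N) := mul_le_mul hle this (abs_nonneg _) hy1.le
      _ = C * q ^ N * (1 / y₁) := by ring
      _ ≤ _ := by
        refine mul_le_mul ?_ (by linarith) hy1.le (by positivity)
        refine mul_le_mul_of_nonneg_right ?_ (by positivity)
        have : (0:ℝ) ≤ 2 ^ N := by positivity
        linarith
  · have h2q : 1 ≤ 2 * q := by linarith
    have hmN : ∀ m ≤ N, q ^ m ≤ 2 ^ N * q ^ N := fun m hm => by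
      calc q ^ m ≤ (2 * q) ^ m := pow_le_pow_left₀ hq0 (by linarith) _
        _ ≤ (2 * q) ^ N := pow_le_pow_right₀ h2q hm
        _ = _ := mul_pow _ _ _
    have hsum : |∑ m ∈ Finset.range N, eichlerKernelCoeff m y₁ y₂ * s ^ m| ≤
        (∑ m ∈ Finset.range N, D m * 2 ^ N) * q ^ N * (1 / y₁) := by
      rw [Finset.sum_mul, Finset.sum_mul]
      refine (Finset.abs_sum_le_sum_abs _ _).trans (Finset.sum_le_sum fun m hm => ?_)
      rw [abs_mul, abs_pow]
      calc _ ≤ D m / y₁ ^ m * (1 / y₁) * |s| ^ m := by gcongr; exact hD m y₁ y₂ h₁ h₂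
        _ = D m * (1 / y₁) * q ^ m := by rw [← hqs]; ring
        _ ≤ D m * (1 / y₁) * (2 ^ N * q ^ N) :=
          mul_le_mul_of_nonneg_left (hmN m (Finset.mem_range.1 hm).le)
            (mul_nonneg (hD0 _) hy1.le)
        _ = _ := by ring
    have hKW : |eichlerKernel s y₁ y₂| ≤ 2 ^ N * q ^ N * W := by
      refine hK.trans (le_mul_of_one_le_left hW0 ?_)
      simpa using hmN 0 (Nat.zero_le _)
    calc _ ≤ |eichlerKernel s y₁ y₂| + |∑ m ∈ Finset.range N, eichlerKernelCoeff m y₁ y₂ * s ^ m| :=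
          abs_sub _ _
      _ ≤ 2 ^ N * q ^ N * W + (∑ m ∈ Finset.range N, D m * 2 ^ N) * q ^ N * (1 / y₁) := add_le_add hKW hsum
      _ ≤ _ := by
        have a1 : 0 ≤ C * q ^ N * (1 / y₁ + W) := by positivity
        have a2 : 0 ≤ 2 ^ N * q ^ N * (1 / y₁) := by positivity
        have a3 : 0 ≤ (∑ m ∈ Finset.range N, D m * 2 ^ N) * q ^ N * W := by positivity
        linarith

/-! ### Eichler integrals of flat functions -/

/-- `G y₁ y₂` is *flat* on `0 < y₁ < y₂` if it is measurable (in the coordinates `y₁`, `y₂ - y₁`),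
vanishes to infinite order as `y₁ → 0` and decays exponentially as `y₂ → ∞`. -/
structure IsFlat (G : ℝ → ℝ → ℂ) : Prop where
  meas : AEStronglyMeasurable (fun z : ℝ × ℝ => G z.1 (z.1 + z.2))
    (volume.restrict (Ioi 0 ×ˢ Ioi 0))
  bound : ∃ c > 0, ∀ N : ℕ, ∃ C : ℝ, 0 ≤ C ∧ ∀ y₁ y₂, 0 < y₁ → y₁ < y₂ →
    ‖G y₁ y₂‖ ≤ C * y₁ ^ N * Real.exp (-c * y₂)

/-- `∫ G(y₁, y₂) ((y₁ - s) (y₂ - s)) ^ (-1/2)` over `|s| < y₁ < y₂`. -/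
noncomputable def eichlerIntegral (G : ℝ → ℝ → ℂ) (s : ℝ) : ℂ :=
  ∫ z in Ioi (0 : ℝ) ×ˢ Ioi (0 : ℝ), G z.1 (z.1 + z.2) * (eichlerKernel s z.1 (z.1 + z.2) : ℂ)

/-- The coefficients of the expansion of `eichlerIntegral G s` in powers of `s`. -/
noncomputable def eichlerIntegralCoeff (G : ℝ → ℝ → ℂ) (m : ℕ) : ℂ :=
  ∫ z in Ioi (0 : ℝ) ×ˢ Ioi (0 : ℝ),
    G z.1 (z.1 + z.2) * (eichlerKernelCoeff m z.1 (z.1 + z.2) : ℂ)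

/-- Integrable majorant in one variable of the Taylor remainder away from the singularity. -/
noncomputable def expTail (c : ℝ) : ℝ → ℝ := indicator (Ioi 0) fun u => Real.exp (-c * u)

/-- Integrable majorant in one variable of the kernel at its singularity. -/
noncomputable def expTailSqrt (c : ℝ) : ℝ → ℝ :=
  indicator (Ioi 0) fun u => 1 / √u * Real.exp (-c * u)

lemma integrable_expTail {c : ℝ} (hc : 0 < c) : Integrable (expTail c) :=
  (integrable_indicator_iff measurableSet_Ioi).2 (integrableOn_exp_mul_Ioi (by linarith) 0)

lemma integrableOn_one_div_sqrt_mul_exp {c : ℝ} (hc : 0 < c) :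
    IntegrableOn (fun u : ℝ => 1 / √u * Real.exp (-c * u)) (Ioi 0) := by
  have := integrableOn_rpow_mul_exp_neg_mul_rpow (p := 1) (s := -1 / 2) (b := c)
    (by norm_num) (by norm_num) hc
  refine this.congr_fun (fun u hu => ?_) measurableSet_Ioi
  have hu : 0 < u := hu
  simp only [Real.rpow_one]
  rw [Real.sqrt_eq_rpow, neg_div, Real.rpow_neg hu.le, one_div (u ^ _)]

lemma integrable_expTailSqrt {c : ℝ} (hc : 0 < c) : Integrable (expTailSqrt c) :=
  (integrable_indicator_iff measurableSet_Ioi).2 (integrableOn_one_div_sqrt_mul_exp hc)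

lemma expTail_nonneg (c u : ℝ) : 0 ≤ expTail c u :=
  indicator_nonneg (fun _ _ => by positivity) u

lemma expTailSqrt_nonneg (c u : ℝ) : 0 ≤ expTailSqrt c u :=
  indicator_nonneg (fun _ _ => by positivity) u

/-- The majorant of the integrands below; its integral does not depend on `s`. -/
noncomputable def eichlerMajorant (c s : ℝ) (z : ℝ × ℝ) : ℝ :=
  expTail c z.1 * expTail c z.2 + expTailSqrt c (z.1 - |s|) * expTailSqrt c z.2

lemma eichlerMajorant_nonneg (c s : ℝ) (z : ℝ × ℝ) : 0 ≤ eichlerMajorant c s z :=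
  add_nonneg (mul_nonneg (expTail_nonneg _ _) (expTail_nonneg _ _))
    (mul_nonneg (expTailSqrt_nonneg _ _) (expTailSqrt_nonneg _ _))

lemma integrable_eichlerMajorant {c : ℝ} (hc : 0 < c) (s : ℝ) :
    Integrable (eichlerMajorant c s) :=
  ((integrable_expTail hc).mul_prod (integrable_expTail hc)).add
    (((integrable_expTailSqrt hc).comp_sub_right |s|).mul_prod (integrable_expTailSqrt hc))

lemma integral_eichlerMajorant {c : ℝ} (hc : 0 < c) (s : ℝ) :
    ∫ z, eichlerMajorant c s z = ∫ z, eichlerMajorant c 0 z := by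
  have key : ∀ s, ∫ z, eichlerMajorant c s z =
      (∫ u, expTail c u) * (∫ u, expTail c u) +
        (∫ u, expTailSqrt c u) * (∫ u, expTailSqrt c u) := fun s => by
    have h1 := (integrable_expTail hc).mul_prod (integrable_expTail hc)
    have h2 := ((integrable_expTailSqrt hc).comp_sub_right |s|).mul_prod (integrable_expTailSqrt hc)
    rw [← integral_sub_right_eq_self (expTailSqrt c) |s|]
    nth_rewrite 2 [integral_sub_right_eq_self (expTailSqrt c) |s|]
    rw [← integral_prod_mul, ← integral_prod_mul]
    exact integral_add h1 h2
  rw [key, key]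

lemma mem_quadrant {z : ℝ × ℝ} (hz : z ∈ Ioi (0 : ℝ) ×ˢ Ioi (0 : ℝ)) :
    0 < z.1 ∧ 0 < z.2 ∧ z.1 < z.1 + z.2 :=
  ⟨hz.1, hz.2, lt_add_of_pos_right _ hz.2⟩

lemma measurable_eichlerKernel (s : ℝ) :
    Measurable (fun z : ℝ × ℝ => eichlerKernel s z.1 (z.1 + z.2)) := by
  unfold eichlerKernel
  refine Measurable.ite (measurableSet_lt measurable_const measurable_fst) ?_ measurable_const
  fun_prop

lemma measurable_eichlerKernelCoeff (m : ℕ) :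
    Measurable (fun z : ℝ × ℝ => eichlerKernelCoeff m z.1 (z.1 + z.2)) := by
  unfold eichlerKernelCoeff
  fun_prop

namespace IsFlat

variable {G : ℝ → ℝ → ℂ}

lemma exists_norm_mul_sub_le (hG : IsFlat G) : ∃ c > 0, ∀ N : ℕ, ∃ C : ℝ, 0 ≤ C ∧
    ∀ s : ℝ, ∀ z ∈ Ioi (0 : ℝ) ×ˢ Ioi (0 : ℝ),
      ‖G z.1 (z.1 + z.2) * ((eichlerKernel s z.1 (z.1 + z.2) -
        ∑ m ∈ Finset.range N, eichlerKernelCoeff m z.1 (z.1 + z.2) * s ^ m : ℝ) : ℂ)‖ ≤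
      C * |s| ^ N * eichlerMajorant c s z := by
  obtain ⟨c, hc, H⟩ := hG.bound
  choose D hD0 hD using H
  refine ⟨c, hc, fun N => ?_⟩
  obtain ⟨C, hC0, hC⟩ := abs_eichlerKernel_sub_le N
  refine ⟨C * (D N + D (N + 1)), mul_nonneg hC0 (add_nonneg (hD0 _) (hD0 _)), fun s z hz => ?_⟩
  obtain ⟨h1, h2, h3⟩ := mem_quadrant hz
  rw [norm_mul, Complex.norm_real, Real.norm_eq_abs]
  have hk := hC s z.1 (z.1 + z.2) h1 h3
  have hg := hD N z.1 (z.1 + z.2) h1 h3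
  have hg' := hD (N + 1) z.1 (z.1 + z.2) h1 h3
  obtain ⟨u, v⟩ := z
  simp only at *
  set W : ℝ := if |s| < u then 1 / √(u - |s|) * (1 / √(u + v - u)) else 0 with hW
  have hW0 : 0 ≤ W := by rw [hW]; split_ifs <;> positivity
  have hWle : W * Real.exp (-c * (u + v)) ≤ expTailSqrt c (u - |s|) * expTailSqrt c v := by
    rw [hW]
    unfold expTailSqrt
    rw [indicator_of_mem (show v ∈ Ioi (0:ℝ) from h2)]
    split_ifs with h
    · rw [indicator_of_mem (show u - |s| ∈ Ioi (0:ℝ) from sub_pos.2 h), add_sub_cancel_left]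
      calc _ = 1 / √(u - |s|) * (1 / √v) * Real.exp (-c * (u + v)) := rfl
        _ ≤ 1 / √(u - |s|) * (1 / √v) * Real.exp (-c * (u - |s|) + -c * v) := by
          refine mul_le_mul_of_nonneg_left (Real.exp_le_exp.2 ?_) (by positivity)
          have := mul_nonneg hc.le (abs_nonneg s)
          linarith
        _ = _ := by rw [Real.exp_add]; ring
    · rw [zero_mul]
      exact mul_nonneg (indicator_nonneg (fun _ _ => by positivity) _) (by positivity)
  have hE : Real.exp (-c * (u + v)) = expTail c u * expTail c v := by
    rw [expTail, indicator_of_mem (show v ∈ Ioi (0:ℝ) from h2),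
      indicator_of_mem (show u ∈ Ioi (0:ℝ) from h1), ← Real.exp_add]
    congr 1; ring
  have hpow : 0 < u ^ N := by positivity
  have hu1 : ‖G u (u + v)‖ / u ^ N * (1 / u) ≤ (D N + D (N + 1)) * Real.exp (-c * (u + v)) := by
    rw [div_mul_div_comm, mul_one, ← pow_succ, div_le_iff₀ (by positivity)]
    calc _ ≤ _ := hg'
      _ = D (N + 1) * (u ^ (N + 1) * Real.exp (-c * (u + v))) := by ring
      _ ≤ (D N + D (N + 1)) * (u ^ (N + 1) * Real.exp (-c * (u + v))) :=
        mul_le_mul_of_nonneg_right (by linarith [hD0 N]) (by positivity)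
      _ = _ := by ring
  have hu2 : ‖G u (u + v)‖ / u ^ N ≤ (D N + D (N + 1)) * Real.exp (-c * (u + v)) := by
    rw [div_le_iff₀ hpow]
    calc _ ≤ _ := hg
      _ = D N * (u ^ N * Real.exp (-c * (u + v))) := by ring
      _ ≤ (D N + D (N + 1)) * (u ^ N * Real.exp (-c * (u + v))) :=
        mul_le_mul_of_nonneg_right (by linarith [hD0 (N + 1)]) (by positivity)
      _ = _ := by ring
  have hDD : 0 ≤ D N + D (N + 1) := add_nonneg (hD0 _) (hD0 _)
  calc _ ≤ ‖G u (u + v)‖ * (C * |s| ^ N / u ^ N * (1 / u + W)) :=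
        mul_le_mul_of_nonneg_left hk (norm_nonneg _)
    _ = C * |s| ^ N * (‖G u (u + v)‖ / u ^ N * (1 / u) + ‖G u (u + v)‖ / u ^ N * W) := by ring
    _ ≤ C * |s| ^ N * ((D N + D (N + 1)) * Real.exp (-c * (u + v)) +
          (D N + D (N + 1)) * Real.exp (-c * (u + v)) * W) := by
        gcongr
    _ = C * (D N + D (N + 1)) * |s| ^ N *
          (Real.exp (-c * (u + v)) + W * Real.exp (-c * (u + v))) := by ring
    _ ≤ _ := by
      refine mul_le_mul_of_nonneg_left ?_ (by positivity)
      rw [eichlerMajorant]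
      exact add_le_add hE.le hWle

lemma integrableOn_mul_eichlerKernel (hG : IsFlat G) (s : ℝ) :
    IntegrableOn (fun z : ℝ × ℝ => G z.1 (z.1 + z.2) * (eichlerKernel s z.1 (z.1 + z.2) : ℂ))
      (Ioi 0 ×ˢ Ioi 0) := by
  obtain ⟨c, hc, H⟩ := hG.exists_norm_mul_sub_le
  obtain ⟨C, -, hC⟩ := H 0
  refine Integrable.mono' ((integrable_eichlerMajorant hc s).integrableOn.const_mul C)
    (hG.meas.mul (measurable_eichlerKernel s).complex_ofReal.aestronglyMeasurable) ?_
  filter_upwards [ae_restrict_mem (measurableSet_Ioi.prod measurableSet_Ioi)] with z hz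
  simpa using hC s z hz

lemma integrableOn_mul_eichlerKernelCoeff (hG : IsFlat G) (m : ℕ) :
    IntegrableOn (fun z : ℝ × ℝ => G z.1 (z.1 + z.2) * (eichlerKernelCoeff m z.1 (z.1 + z.2) : ℂ))
      (Ioi 0 ×ˢ Ioi 0) := by
  obtain ⟨c, hc, H⟩ := hG.bound
  obtain ⟨D, hD0, hD⟩ := H (m + 1)
  obtain ⟨C, hC0, hC⟩ := abs_eichlerKernelCoeff_le m
  refine Integrable.mono' (((integrable_expTail hc).mul_prod
    (integrable_expTail hc)).integrableOn.const_mul (D * C))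
    (hG.meas.mul (measurable_eichlerKernelCoeff m).complex_ofReal.aestronglyMeasurable) ?_
  filter_upwards [ae_restrict_mem (measurableSet_Ioi.prod measurableSet_Ioi)] with z hz
  obtain ⟨h1, h2, h3⟩ := mem_quadrant hz
  rw [norm_mul, Complex.norm_real, Real.norm_eq_abs]
  calc _ ≤ D * z.1 ^ (m + 1) * Real.exp (-c * (z.1 + z.2)) * (C / z.1 ^ m * (1 / z.1)) :=
        mul_le_mul (hD _ _ h1 h3) (hC _ _ h1 h3) (abs_nonneg _) (by positivity)
    _ = D * C * Real.exp (-c * z.1 + -c * z.2) := by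
      rw [← mul_add]; field_simp; ring
    _ = _ := by
      rw [Real.exp_add, expTail, indicator_of_mem hz.1, indicator_of_mem hz.2]

/-- The integral against the cut-off kernel has one expansion in powers of `s`, valid for both
signs of `s`. -/
theorem norm_eichlerIntegral_sub_le (hG : IsFlat G) (N : ℕ) : ∃ C : ℝ, ∀ s : ℝ,
    ‖eichlerIntegral G s - ∑ m ∈ Finset.range N, eichlerIntegralCoeff G m * (s : ℂ) ^ m‖ ≤
      C * |s| ^ N := by
  obtain ⟨c, hc, H⟩ := hG.exists_norm_mul_sub_le
  obtain ⟨C, hC0, hC⟩ := H N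
  refine ⟨C * ∫ z, eichlerMajorant c 0 z, fun s => ?_⟩
  have e : eichlerIntegral G s - ∑ m ∈ Finset.range N, eichlerIntegralCoeff G m * (s : ℂ) ^ m =
      ∫ z in Ioi (0 : ℝ) ×ˢ Ioi (0 : ℝ), G z.1 (z.1 + z.2) *
        ((eichlerKernel s z.1 (z.1 + z.2) -
          ∑ m ∈ Finset.range N, eichlerKernelCoeff m z.1 (z.1 + z.2) * s ^ m : ℝ) : ℂ) := by
    simp_rw [eichlerIntegral, eichlerIntegralCoeff, ← integral_mul_const]
    rw [← integral_finsetSum _ fun m _ =>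
        (hG.integrableOn_mul_eichlerKernelCoeff m).mul_const _,
      ← integral_sub (hG.integrableOn_mul_eichlerKernel s)
        (integrable_finsetSum _ fun m _ =>
          (hG.integrableOn_mul_eichlerKernelCoeff m).mul_const _)]
    refine integral_congr_ae (Eventually.of_forall fun z => ?_)
    simp only
    push_cast
    rw [mul_sub, Finset.mul_sum]
    simp only [mul_assoc]
  rw [e, ← integral_eichlerMajorant hc s]
  have hint := (integrable_eichlerMajorant hc s).const_mul (C * |s| ^ N)
  calc _ ≤ ∫ z in Ioi (0 : ℝ) ×ˢ Ioi (0 : ℝ), C * |s| ^ N * eichlerMajorant c s z := by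
        refine norm_integral_le_of_norm_le hint.integrableOn ?_
        filter_upwards [ae_restrict_mem (measurableSet_Ioi.prod measurableSet_Ioi)] with z hz
        exact hC s z hz
    _ ≤ ∫ z, C * |s| ^ N * eichlerMajorant c s z :=
        setIntegral_le_integral hint (Eventually.of_forall fun z =>
          mul_nonneg (by positivity) (eichlerMajorant_nonneg _ _ _))
    _ = _ := by rw [integral_const_mul]; ring

end IsFlat

lemma IsFlat.add {G H : ℝ → ℝ → ℂ} (hG : IsFlat G) (hH : IsFlat H) :
    IsFlat fun y₁ y₂ => G y₁ y₂ + H y₁ y₂ := by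
  refine ⟨hG.meas.add hH.meas, ?_⟩
  obtain ⟨b, hb, hB⟩ := hG.bound
  obtain ⟨c, hc, hC⟩ := hH.bound
  refine ⟨min b c, lt_min hb hc, fun N => ?_⟩
  obtain ⟨B, hB0, hB⟩ := hB N
  obtain ⟨C, hC0, hC⟩ := hC N
  refine ⟨B + C, by positivity, fun y₁ y₂ h₁ h₂ => ?_⟩
  have h₃ : 0 < y₂ := h₁.trans h₂
  calc _ ≤ ‖G y₁ y₂‖ + ‖H y₁ y₂‖ := norm_add_le _ _
    _ ≤ B * y₁ ^ N * Real.exp (-b * y₂) + C * y₁ ^ N * Real.exp (-c * y₂) :=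
      add_le_add (hB _ _ h₁ h₂) (hC _ _ h₁ h₂)
    _ ≤ B * y₁ ^ N * Real.exp (-min b c * y₂) + C * y₁ ^ N * Real.exp (-min b c * y₂) := by
      gcongr
      · exact min_le_left _ _
      · exact min_le_right _ _
    _ = _ := by ring

lemma eichlerIntegral_add {G H : ℝ → ℝ → ℂ} (hG : IsFlat G) (hH : IsFlat H) (s : ℝ) :
    eichlerIntegral (fun y₁ y₂ => G y₁ y₂ + H y₁ y₂) s =
      eichlerIntegral G s + eichlerIntegral H s := by
  rw [eichlerIntegral, eichlerIntegral, eichlerIntegral, ← integral_add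
    (hG.integrableOn_mul_eichlerKernel s) (hH.integrableOn_mul_eichlerKernel s)]
  simp_rw [add_mul]

/-! ### Flatness of theta series with a linear factor in each variable -/

/-- The sine kernel decays faster than any power at `∞`, uniformly in the shift. -/
lemma abs_sinKernel_le {k : ℕ} (hk : 2 ≤ k) : ∃ C : ℝ, 0 ≤ C ∧ ∀ a t : ℝ, 0 < t →
    |HurwitzZeta.sinKernel (a : UnitAddCircle) t| ≤ C / t ^ k := by
  have hs : Summable fun n : ℕ => 1 / (n : ℝ) ^ 2 := Real.summable_one_div_nat_pow.2 (by norm_num)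
  refine ⟨2 * k.factorial * ∑' n : ℕ, 1 / (n : ℝ) ^ 2, ?_, fun a t ht => ?_⟩
  · have : 0 ≤ ∑' n : ℕ, 1 / (n : ℝ) ^ 2 := tsum_nonneg fun n => by positivity
    positivity
  have hg := hs.hasSum.mul_left (2 * k.factorial / t ^ k)
  rw [mul_div_right_comm]
  refine (HurwitzZeta.hasSum_nat_sinKernel a ht).norm_le_of_bounded hg fun n => ?_
  rcases Nat.eq_zero_or_pos n with rfl | hn
  · simp
  have hn1 : (1 : ℝ) ≤ n := by exact_mod_cast hn
  have hu : 0 < (n : ℝ) ^ 2 * t := by positivity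
  have h1 : Real.exp (-Real.pi * n ^ 2 * t) ≤ k.factorial / ((n : ℝ) ^ 2 * t) ^ k := by
    have := Real.pow_div_factorial_le_exp _ hu.le k
    calc Real.exp (-Real.pi * n ^ 2 * t) ≤ Real.exp (-((n : ℝ) ^ 2 * t)) := by
          refine Real.exp_le_exp.2 ?_
          nlinarith [Real.pi_gt_three]
      _ = (Real.exp ((n : ℝ) ^ 2 * t))⁻¹ := Real.exp_neg _
      _ ≤ (((n : ℝ) ^ 2 * t) ^ k / k.factorial)⁻¹ := inv_anti₀ (by positivity) this
      _ = _ := inv_div _ _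
  rw [Real.norm_eq_abs, abs_mul, abs_mul, abs_of_nonneg (by positivity : (0:ℝ) ≤ 2 * n),
    abs_of_pos (Real.exp_pos _)]
  have h2 : (n : ℝ) / ((n : ℝ) ^ 2) ^ k ≤ 1 / (n : ℝ) ^ 2 := by
    rw [div_le_div_iff₀ (by positivity) (by positivity), one_mul, ← pow_succ', ← pow_mul]
    exact pow_le_pow_right₀ hn1 (by omega)
  calc _ ≤ 2 * (n : ℝ) * 1 * (k.factorial / ((n : ℝ) ^ 2 * t) ^ k) := by
        gcongr
        exact Real.abs_sin_le_one _
    _ = 2 * k.factorial / t ^ k * (n / ((n : ℝ) ^ 2) ^ k) := by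
        rw [mul_pow]; field_simp
    _ ≤ _ := by gcongr

/-- The odd theta kernel vanishes to infinite order at `0`, uniformly in the shift. -/
lemma abs_oddKernel_le (N : ℕ) : ∃ C : ℝ, 0 ≤ C ∧ ∀ a x : ℝ, 0 < x →
    |HurwitzZeta.oddKernel (a : UnitAddCircle) x| ≤ C * x ^ (N + 1) := by
  obtain ⟨C₁, h₁, H₁⟩ := abs_sinKernel_le (k := N + 3) (by omega)
  obtain ⟨C₂, h₂, H₂⟩ := abs_sinKernel_le (k := N + 2) (by omega)
  refine ⟨C₁ + C₂, by positivity, fun a x hx => ?_⟩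
  have e1 := H₁ a (1 / x) (by positivity)
  have e2 := H₂ a (1 / x) (by positivity)
  rw [one_div, inv_pow, div_inv_eq_mul] at e1 e2
  rw [HurwitzZeta.oddKernel_functional_equation, abs_mul, abs_of_pos (by positivity), one_div x]
  -- The weight `x ^ (-3/2)` is at most `x ^ (-2)` for `x ≤ 1` and at most `x ^ (-1)` for `x ≥ 1`.
  rcases le_or_gt x 1 with h | h
  · have : 1 / x ^ (3 / 2 : ℝ) ≤ 1 / x ^ 2 := by
      refine one_div_le_one_div_of_le (by positivity) ?_
      rw [← Real.rpow_natCast]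
      exact Real.rpow_le_rpow_of_exponent_ge hx h (by norm_num)
    calc _ ≤ 1 / x ^ 2 * (C₁ * x ^ (N + 3)) := mul_le_mul this e1 (abs_nonneg _) (by positivity)
      _ = C₁ * x ^ (N + 1) := by field_simp; ring
      _ ≤ _ := by gcongr; linarith
  · have : 1 / x ^ (3 / 2 : ℝ) ≤ 1 / x := by
      refine one_div_le_one_div_of_le (by positivity) ?_
      nth_rewrite 1 [← Real.rpow_one x]
      exact Real.rpow_le_rpow_of_exponent_le h.le (by norm_num)
    calc _ ≤ 1 / x * (C₂ * x ^ (N + 2)) := mul_le_mul this e2 (abs_nonneg _) (by positivity)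
      _ = C₂ * x ^ (N + 1) := by field_simp; ring
      _ ≤ _ := by gcongr; linarith

lemma summable_mul_exp_neg_sq (δ : ℝ) {c y : ℝ} (hc : 0 < c) (hy : 0 < y) :
    Summable fun j : ℤ => (2 * j + δ) * Real.exp (-Real.pi * (c * (2 * j + δ) ^ 2 * y)) := by
  have := (HurwitzZeta.hasSum_int_oddKernel (δ / 2) (x := 4 * c * y) (by positivity)).summable
  refine (this.mul_left 2).congr fun j => ?_
  rw [← mul_assoc]
  congr 2 <;> ring

/-- One-dimensional theta series of weight `3/2` with periodic bounded coefficients vanish to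
infinite order at `0`: split into residue classes and use the functional equation. -/
lemma norm_tsum_periodic_mul_exp_le (K : ℕ) [NeZero K] {c : ℝ} (hc : 0 < c) (N : ℕ) :
    ∃ C : ℝ, 0 ≤ C ∧ ∀ (χ : ℤ → ℂ), (∀ j, χ (j + K) = χ j) → (∀ j, ‖χ j‖ ≤ 1) →
      ∀ δ y : ℝ, 0 < y →
      ‖∑' j : ℤ, χ j * (((2 * j + δ) * Real.exp (-Real.pi * (c * (2 * j + δ) ^ 2 * y)) : ℝ) : ℂ)‖ ≤
        C * y ^ (N + 1) := by
  obtain ⟨C, hC0, hC⟩ := abs_oddKernel_le N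
  have hK : (0 : ℝ) < K := by exact_mod_cast Nat.pos_of_ne_zero (NeZero.ne K)
  refine ⟨K * (2 * K * (C * (4 * K ^ 2 * c) ^ (N + 1))), by positivity, fun χ hper hχ δ y hy => ?_⟩
  obtain ⟨f, hf⟩ : ∃ f : ℤ → ℂ, f = fun j =>
    χ j * (((2 * j + δ) * Real.exp (-Real.pi * (c * (2 * j + δ) ^ 2 * y)) : ℝ) : ℂ) := ⟨_, rfl⟩
  rw [← hf]
  have hsum : Summable f := by
    refine Summable.of_norm_bounded (summable_mul_exp_neg_sq δ hc hy).abs fun j => ?_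
    rw [hf, norm_mul, Complex.norm_real, Real.norm_eq_abs]
    exact mul_le_of_le_one_left (abs_nonneg _) (hχ j)
  have hχ' : ∀ i r : ℤ, χ (i * K + r) = χ r := fun i r => by
    have := (show Function.Periodic χ (K : ℤ) from hper).int_mul i
    rw [add_comm]; exact this r
  obtain ⟨e, he⟩ : ∃ e : Fin K × ℤ ≃ ℤ, ∀ (r : Fin K) (i : ℤ), e (r, i) = i * K + (r : ℕ) :=
    ⟨((Int.divModEquiv K).trans (Equiv.prodComm ℤ (Fin K))).symm, fun _ _ => rfl⟩
  rw [← e.tsum_eq f, Summable.tsum_prod (f := fun c => f (e c)) (e.summable_iff.2 hsum), tsum_fintype]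
  refine (norm_sum_le _ _).trans ?_
  have hr : ∀ r : Fin K, ‖∑' i : ℤ, f (e (r, i))‖ ≤
      2 * K * (C * (4 * K ^ 2 * c) ^ (N + 1)) * y ^ (N + 1) := fun r => by
    have hx : 0 < 4 * K ^ 2 * c * y := by positivity
    have hodd := HurwitzZeta.hasSum_int_oddKernel ((2 * (r : ℕ) + δ) / (2 * K)) hx
    have h1 : ∀ i : ℤ, f (e (r, i)) = χ ((r : ℕ) : ℤ) * ((2 * K *
        ((i + (2 * (r : ℕ) + δ) / (2 * K)) *
          Real.exp (-Real.pi * (i + (2 * (r : ℕ) + δ) / (2 * K)) ^ 2 * (4 * K ^ 2 * c * y))) : ℝ) :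
            ℂ) := fun i => by
      simp only [hf]
      rw [he, hχ', ← mul_assoc (2 * (K : ℝ))]
      congr 3
      · push_cast; field_simp; ring
      · congr 1; push_cast; field_simp; ring
    simp_rw [h1]
    rw [tsum_mul_left, ← Complex.ofReal_tsum, tsum_mul_left, hodd.tsum_eq, norm_mul,
      Complex.norm_real, Real.norm_eq_abs, abs_mul, abs_of_pos (by positivity : (0:ℝ) < 2 * K)]
    calc _ ≤ 1 * (2 * K * (C * (4 * K ^ 2 * c * y) ^ (N + 1))) := by
          gcongr
          · exact hχ _
          · exact hC _ _ hx
      _ = _ := by rw [mul_pow _ y]; ring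
  calc _ ≤ ∑ _r : Fin K, 2 * K * (C * (4 * K ^ 2 * c) ^ (N + 1)) * y ^ (N + 1) :=
        Finset.sum_le_sum fun r _ => hr r
    _ = _ := by rw [Finset.sum_const, Finset.card_univ, Fintype.card_fin, nsmul_eq_mul]; ring

lemma exists_le_abs_add_int (γ : ℝ) : ∃ d > 0, ∀ m : ℤ, γ + m = 0 ∨ d ≤ |γ + m| := by
  have h0 := Int.fract_nonneg γ
  have h1 := Int.fract_lt_one γ
  have hm : ∀ m : ℤ, γ + m = Int.fract γ + ((⌊γ⌋ + m : ℤ) : ℝ) := fun m => by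
    push_cast; linarith [Int.fract_add_floor γ]
  rcases h0.eq_or_lt with h | h
  · refine ⟨1, one_pos, fun m => ?_⟩
    rw [hm, ← h, zero_add]
    rcases eq_or_ne (⌊γ⌋ + m) 0 with h' | h'
    · left; exact_mod_cast h'
    · right; exact_mod_cast Int.one_le_abs h'
  · refine ⟨min (Int.fract γ) (1 - Int.fract γ), lt_min h (by linarith), fun m => Or.inr ?_⟩
    rw [hm]
    rcases le_or_gt 0 (⌊γ⌋ + m) with h' | h'
    · have : (0 : ℝ) ≤ ((⌊γ⌋ + m : ℤ) : ℝ) := by exact_mod_cast h'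
      exact (min_le_left _ _).trans (by rw [abs_of_nonneg (by linarith)]; linarith)
    · have : ((⌊γ⌋ + m : ℤ) : ℝ) ≤ -1 := by
        have : ⌊γ⌋ + m ≤ -1 := by omega
        exact_mod_cast this
      exact (min_le_right _ _).trans (by rw [abs_of_neg (by linarith)]; linarith)

/-- The outer sum: the terms with `γ + m = 0` drop out, so that the sum decays exponentially. -/
lemma tsum_abs_mul_exp_le (γ : ℝ) {c : ℝ} (hc : 0 < c) : ∃ b > 0, ∃ C : ℝ, 0 ≤ C ∧ ∀ y : ℝ, 0 < y →
    Summable (fun m : ℤ => |γ + m| * Real.exp (-Real.pi * (c * (γ + m) ^ 2 * y))) ∧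
    ∑' m : ℤ, |γ + m| * Real.exp (-Real.pi * (c * (γ + m) ^ 2 * y)) ≤
      C / y ^ 2 * Real.exp (-b * y) := by
  obtain ⟨d, hd, H⟩ := exists_le_abs_add_int γ
  have hs := (Real.summable_one_div_int_add_rpow γ 3).2 (by norm_num)
  refine ⟨c * d ^ 2 / 2, by positivity, 8 / c ^ 2 * ∑' n : ℤ, 1 / |(n : ℝ) + γ| ^ (3 : ℝ), ?_,
    fun y hy => ?_⟩
  · have : 0 ≤ ∑' n : ℤ, 1 / |(n : ℝ) + γ| ^ (3 : ℝ) := tsum_nonneg fun n => by positivity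
    positivity
  have hg := hs.hasSum.mul_left (8 / c ^ 2 / y ^ 2 * Real.exp (-(c * d ^ 2 / 2) * y))
  have hle : ∀ m : ℤ, |γ + m| * Real.exp (-Real.pi * (c * (γ + m) ^ 2 * y)) ≤
      8 / c ^ 2 / y ^ 2 * Real.exp (-(c * d ^ 2 / 2) * y) * (1 / |(m : ℝ) + γ| ^ (3 : ℝ)) :=
      fun m => by
    rcases H m with h | h
    · rw [h]; simp; positivity
    rw [add_comm (m : ℝ) γ]
    set η := |γ + m| with hη
    have hη0 : 0 < η := hd.trans_le h
    have hsq : (γ + m) ^ 2 = η ^ 2 := (sq_abs _).symm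
    rw [hsq, show (3 : ℝ) = ((3 : ℕ) : ℝ) by norm_num, Real.rpow_natCast]
    have hu : 0 ≤ c * η ^ 2 * y / 2 := by positivity
    have h1 := Real.pow_div_factorial_le_exp _ hu 2
    have h2 : Real.exp (-(c * η ^ 2 * y / 2)) ≤ 8 / c ^ 2 / y ^ 2 / η ^ 4 := by
      rw [Real.exp_neg]
      calc _ ≤ ((c * η ^ 2 * y / 2) ^ 2 / (Nat.factorial 2))⁻¹ := inv_anti₀ (by positivity) h1
        _ = _ := by simp only [Nat.factorial]; field_simp; norm_num
    have h3 : Real.exp (-Real.pi * (c * η ^ 2 * y)) ≤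
        Real.exp (-(c * η ^ 2 * y / 2)) * Real.exp (-(c * d ^ 2 / 2) * y) := by
      rw [← Real.exp_add]
      refine Real.exp_le_exp.2 ?_
      have : c * d ^ 2 * y ≤ c * η ^ 2 * y := by gcongr
      have : 0 ≤ c * η ^ 2 * y := by positivity
      nlinarith [Real.pi_gt_three]
    calc _ ≤ η * (8 / c ^ 2 / y ^ 2 / η ^ 4 * Real.exp (-(c * d ^ 2 / 2) * y)) := by
          gcongr; exact h3.trans (by gcongr)
      _ = _ := by field_simp
  have hsm := Summable.of_nonneg_of_le (fun m => by positivity) hle hg.summable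
  refine ⟨hsm, (hsm.tsum_le_tsum hle hg.summable).trans (le_of_eq ?_)⟩
  rw [hg.tsum_eq]; ring

/-- A rank two theta series with a linear factor in each variable and with periodic coefficients in
the inner variable is flat on `0 < y₁ < y₂`. -/
lemma norm_tsum_tsum_le (K : ℕ) [NeZero K] {c₁ c₂ : ℝ} (h₁ : 0 < c₁) (h₂ : 0 < c₂) (γ : ℝ)
    (δ : ℤ → ℝ) (χ : ℤ → ℤ → ℂ) (hper : ∀ m j, χ m (j + K) = χ m j) (hχ : ∀ m j, ‖χ m j‖ ≤ 1) :
    ∃ b > 0, ∀ N : ℕ, ∃ C : ℝ, 0 ≤ C ∧ ∀ y₁ y₂ : ℝ, 0 < y₁ → y₁ < y₂ →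
      ‖∑' m : ℤ, ∑' j : ℤ, ((((γ + m) * Real.exp (-Real.pi * (c₂ * (γ + m) ^ 2 * y₂))) : ℝ) : ℂ) *
        (χ m j * (((2 * j + δ m) * Real.exp (-Real.pi * (c₁ * (2 * j + δ m) ^ 2 * y₁)) : ℝ) : ℂ))‖
      ≤ C * y₁ ^ N * Real.exp (-b * y₂) := by
  obtain ⟨b, hb, B, hB0, hB⟩ := tsum_abs_mul_exp_le γ h₂
  refine ⟨b, hb, fun N => ?_⟩
  obtain ⟨C, hC0, hC⟩ := norm_tsum_periodic_mul_exp_le K h₁ (N + 1)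
  refine ⟨C * B, by positivity, fun y₁ y₂ hy₁ hy₂ => ?_⟩
  have hy : 0 < y₂ := hy₁.trans hy₂
  obtain ⟨hs, hle⟩ := hB y₂ hy
  -- The factor `y₂ ^ (-2)` of the outer sum is at most `y₁ ^ (-2)`, whence the exponent `N + 2`.
  simp_rw [tsum_mul_left]
  refine (tsum_of_norm_bounded (hs.hasSum.mul_right (C * y₁ ^ (N + 1 + 1))) fun m => ?_).trans ?_
  · rw [norm_mul, Complex.norm_real, Real.norm_eq_abs, abs_mul, abs_of_pos (Real.exp_pos _)]
    gcongr
    exact hC _ (hper m) (hχ m) _ _ hy₁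
  · calc _ ≤ B / y₂ ^ 2 * Real.exp (-b * y₂) * (C * y₁ ^ (N + 1 + 1)) := by gcongr
      _ ≤ B / y₁ ^ 2 * Real.exp (-b * y₂) * (C * y₁ ^ (N + 1 + 1)) := by gcongr
      _ = _ := by field_simp; ring

/-! ### The two theta series of the form `Q` -/

lemma Q_ge (x y : ℝ) : (x ^ 2 + y ^ 2) / 6 ≤ Q x y := by
  unfold Q; nlinarith [sq_nonneg (17 * x + 9 * y), sq_nonneg (3 * x + 2 * y), sq_nonneg y]

lemma Q_nonneg (x y : ℝ) : 0 ≤ Q x y := le_trans (by positivity) (Q_ge x y)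

lemma summable_exp_neg_sq (a : ℝ) {c : ℝ} (hc : 0 < c) :
    Summable fun n : ℤ => Real.exp (-c * (a + n) ^ 2) := by
  refine (HurwitzZeta.hasSum_int_evenKernel a
    (div_pos hc Real.pi_pos)).summable.congr fun n => ?_
  congr 1
  field_simp; ring

lemma summable_exp_neg_Q (α : ℝ × ℝ) {c : ℝ} (hc : 0 < c) :
    Summable fun n : ℤ × ℤ => Real.exp (-c * Q (α.1 + n.1) (α.2 + n.2)) := by
  have h := (summable_exp_neg_sq α.1 (c := c / 6) (by positivity)).mul_of_nonneg
    (summable_exp_neg_sq α.2 (c := c / 6) (by positivity))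
    (fun _ => by positivity) (fun _ => by positivity)
  refine Summable.of_nonneg_of_le (fun _ => by positivity) (fun n => ?_) h
  rw [← Real.exp_add]
  refine Real.exp_le_exp.2 ?_
  have := mul_le_mul_of_nonneg_left (Q_ge (α.1 + n.1) (α.2 + n.2)) hc.le
  linarith

lemma norm_qpow_ofReal (x r : ℝ) : ‖qpow x r‖ = 1 := by
  rw [qpow, show (2 * Real.pi * Complex.I * x * r : ℂ) = ((2 * Real.pi * x * r : ℝ) : ℂ) * Complex.I by
    push_cast; ring]
  exact Complex.norm_exp_ofReal_mul_I _

/-- Phases of the theta series are periodic: a change of `r` that makes `x r` change by an integer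
does not affect `e ^ (2 π i x r)`. -/
lemma qpow_eq_of_mul_eq_add_int {x r r' : ℝ} (n : ℤ) (h : x * r' = x * r + n) :
    qpow x r' = qpow x r := by
  rw [qpow, qpow, Complex.exp_eq_exp_iff_exists_int]
  refine ⟨n, ?_⟩
  have : (x : ℂ) * r' = x * r + n := by exact_mod_cast h
  linear_combination (2 * Real.pi * Complex.I) * this

/-- The odd Gaussian `A B e ^ (-π (A² y₁ + B² y₂) / 2)`. -/
noncomputable def oddGaussian (A B y₁ y₂ : ℝ) : ℝ :=
  A * B * Real.exp (-(Real.pi / 2) * (A ^ 2 * y₁ + B ^ 2 * y₂))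

/-- The orthogonal coordinates `(√3 (2 n₁ + n₂), n₂)`, whose sum of squares is `4 Q(n)`. -/
noncomputable def orthoCoord₁ (x y : ℝ) : ℝ × ℝ := (√3 * (2 * x + y), y)

/-- The orthogonal coordinates `(3 n₁ + 2 n₂, √3 n₁)`, whose sum of squares is `4 Q(n)`. -/
noncomputable def orthoCoord₂ (x y : ℝ) : ℝ × ℝ := (3 * x + 2 * y, √3 * x)

lemma sq_sqrt_three : √3 ^ 2 = (3 : ℝ) := Real.sq_sqrt (by norm_num)

lemma orthoCoord₁_sq (x y : ℝ) :
    (orthoCoord₁ x y).1 ^ 2 + (orthoCoord₁ x y).2 ^ 2 = 4 * Q x y := by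
  simp only [orthoCoord₁, Q, mul_pow, sq_sqrt_three]; ring

lemma orthoCoord₂_sq (x y : ℝ) :
    (orthoCoord₂ x y).1 ^ 2 + (orthoCoord₂ x y).2 ^ 2 = 4 * Q x y := by
  simp only [orthoCoord₂, Q, mul_pow, sq_sqrt_three]; ring

/-- The general term of the theta series at `(x + i y₁, x + i y₂)` belonging to the orthogonal
coordinates `L`, at the lattice point `α + n`. -/
noncomputable def thetaTerm (L : ℝ → ℝ → ℝ × ℝ) (α : ℝ × ℝ) (x y₁ y₂ : ℝ) (n : ℤ × ℤ) : ℂ :=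
  qpow x (Q (α.1 + n.1) (α.2 + n.2)) *
    (oddGaussian (L (α.1 + n.1) (α.2 + n.2)).1 (L (α.1 + n.1) (α.2 + n.2)).2 y₁ y₂ : ℂ)

/-- The theta series at `(x + i y₁, x + i y₂)` belonging to the orthogonal coordinates `L`. -/
noncomputable def thetaSeries (L : ℝ → ℝ → ℝ × ℝ) (α : ℝ × ℝ) (x y₁ y₂ : ℝ) : ℂ :=
  ∑' n : ℤ × ℤ, thetaTerm L α x y₁ y₂ n

lemma sqrt_three_mul_theta1 (α : ℝ × ℝ) (x y₁ y₂ : ℝ) :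
    (√3 : ℂ) * theta1 α (x + y₁ * Complex.I) (x + y₂ * Complex.I) =
      thetaSeries orthoCoord₁ α x y₁ y₂ := by
  rw [theta1, thetaSeries, ← tsum_mul_left]
  refine tsum_congr fun n => ?_
  have h3 : ((√3 : ℝ) : ℂ) ^ 2 = 3 := by exact_mod_cast sq_sqrt_three
  simp only [thetaTerm, oddGaussian, orthoCoord₁, qpow, Q]
  push_cast
  rw [mul_pow, h3, mul_left_comm (Complex.exp _), ← Complex.exp_add, ← mul_assoc]
  congr 1
  · ring
  · congr 1
    linear_combination (3 * (Real.pi : ℂ) / 2 * (2 * (α.1 + n.1) + (α.2 + n.2)) ^ 2 * y₁ +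
      Real.pi / 2 * (α.2 + n.2) ^ 2 * y₂) * Complex.I_sq

lemma sqrt_three_mul_theta2 (α : ℝ × ℝ) (x y₁ y₂ : ℝ) :
    (√3 : ℂ) * theta2 α (x + y₁ * Complex.I) (x + y₂ * Complex.I) =
      thetaSeries orthoCoord₂ α x y₁ y₂ := by
  rw [theta2, thetaSeries, ← tsum_mul_left]
  refine tsum_congr fun n => ?_
  have h3 : ((√3 : ℝ) : ℂ) ^ 2 = 3 := by exact_mod_cast sq_sqrt_three
  simp only [thetaTerm, oddGaussian, orthoCoord₂, qpow, Q]
  push_cast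
  rw [mul_pow, h3, mul_left_comm (Complex.exp _), ← Complex.exp_add, ← mul_assoc]
  congr 1
  · ring
  · congr 1
    linear_combination ((Real.pi : ℂ) / 2 * (3 * (α.1 + n.1) + 2 * (α.2 + n.2)) ^ 2 * y₁ +
      3 * Real.pi / 2 * (α.1 + n.1) ^ 2 * y₂) * Complex.I_sq

lemma summable_thetaTerm {L : ℝ → ℝ → ℝ × ℝ}
    (hL : ∀ x y, (L x y).1 ^ 2 + (L x y).2 ^ 2 = 4 * Q x y) (α : ℝ × ℝ) (x : ℝ) {y₁ y₂ : ℝ} (h₁ : 0 < y₁) (h₂ : y₁ < y₂) :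
    Summable (thetaTerm L α x y₁ y₂) := by
  have hπ := Real.pi_pos
  refine Summable.of_norm_bounded
    ((summable_exp_neg_Q α (c := Real.pi * y₁) (by positivity)).mul_left (2 / (Real.pi * y₁)))
    fun n => ?_
  rw [thetaTerm, norm_mul, norm_qpow_ofReal, one_mul, Complex.norm_real, Real.norm_eq_abs,
    oddGaussian, abs_mul, abs_of_pos (Real.exp_pos _)]
  have hq := hL (α.1 + n.1) (α.2 + n.2)
  have hq0 := Q_nonneg (α.1 + n.1) (α.2 + n.2)
  set A := (L (α.1 + n.1) (α.2 + n.2)).1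
  set B := (L (α.1 + n.1) (α.2 + n.2)).2
  set q := Q (α.1 + n.1) (α.2 + n.2)
  have hAB : |A * B| ≤ 2 * q := by
    rw [abs_le]; constructor <;> nlinarith [sq_nonneg (A + B), sq_nonneg (A - B)]
  have hexp : Real.exp (-(Real.pi / 2) * (A ^ 2 * y₁ + B ^ 2 * y₂)) ≤
      Real.exp (-(Real.pi * y₁) * q) * Real.exp (-(Real.pi * y₁) * q) := by
    rw [← Real.exp_add]
    refine Real.exp_le_exp.2 ?_
    have : B ^ 2 * y₁ ≤ B ^ 2 * y₂ := mul_le_mul_of_nonneg_left h₂.le (sq_nonneg B)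
    have h4 : 4 * q * y₁ ≤ A ^ 2 * y₁ + B ^ 2 * y₂ := by rw [← hq]; linarith
    nlinarith
  have hle : 2 * q * Real.exp (-(Real.pi * y₁) * q) ≤ 2 / (Real.pi * y₁) := by
    rw [neg_mul, Real.exp_neg, ← div_eq_mul_inv, div_le_div_iff₀ (Real.exp_pos _) (by positivity)]
    have := Real.add_one_le_exp (Real.pi * y₁ * q)
    linarith
  calc _ ≤ 2 * q * (Real.exp (-(Real.pi * y₁) * q) * Real.exp (-(Real.pi * y₁) * q)) := by gcongr
    _ = 2 * q * Real.exp (-(Real.pi * y₁) * q) * Real.exp (-(Real.pi * y₁) * q) := by ring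
    _ ≤ _ := by gcongr

lemma aestronglyMeasurable_thetaSeries {L : ℝ → ℝ → ℝ × ℝ}
    (hL : ∀ x y, (L x y).1 ^ 2 + (L x y).2 ^ 2 = 4 * Q x y) (α : ℝ × ℝ) (x : ℝ) :
    AEStronglyMeasurable (fun z : ℝ × ℝ => thetaSeries L α x z.1 (z.1 + z.2))
      (volume.restrict (Ioi 0 ×ˢ Ioi 0)) := by
  refine aestronglyMeasurable_of_tendsto_ae (atTop : Filter (Finset (ℤ × ℤ)))
    (f := fun s z => ∑ n ∈ s, thetaTerm L α x z.1 (z.1 + z.2) n) (fun s => ?_) ?_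
  · refine Continuous.aestronglyMeasurable ?_
    refine continuous_finsetSum _ fun n _ => ?_
    unfold thetaTerm oddGaussian
    fun_prop
  · filter_upwards [ae_restrict_mem (measurableSet_Ioi.prod measurableSet_Ioi)] with z hz
    obtain ⟨h1, -, h3⟩ := mem_quadrant hz
    exact (summable_thetaTerm hL α x h1 h3).hasSum

lemma isFlat_thetaSeries₁ {α : ℝ × ℝ} {p : ℕ} (hp : 0 < p) {a₁ a₂ : ℤ} (h₁ : α.1 = a₁ / p)
    (h₂ : α.2 = a₂ / p) (h : ℤ) {k : ℕ} (hk : 0 < k) :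
    IsFlat (thetaSeries orthoCoord₁ α (h / k)) := by
  refine ⟨aestronglyMeasurable_thetaSeries orthoCoord₁_sq α _, ?_⟩
  have : NeZero (k * p) := ⟨by positivity⟩
  have hp' : (p : ℝ) ≠ 0 := by positivity
  have hk' : (k : ℝ) ≠ 0 := by positivity
  obtain ⟨b, hb, H⟩ := norm_tsum_tsum_le (k * p) (c₁ := 3 / 2) (c₂ := 1 / 2) (by norm_num)
    (by norm_num) α.2 (fun m => 2 * α.1 + α.2 + m)
    (fun m j => qpow (h / k : ℝ) (Q (α.1 + j) (α.2 + m)))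
    (fun m j => qpow_eq_of_mul_eq_add_int
      (h * (6 * a₁ + 6 * p * j + 3 * p * (k * p) + 3 * a₂ + 3 * p * m)) (by
        simp only [Q, h₁, h₂]; push_cast; field_simp; ring))
    (fun m j => (norm_qpow_ofReal _ _).le)
  refine ⟨b, hb, fun N => ?_⟩
  obtain ⟨C, hC0, hC⟩ := H N
  refine ⟨√3 * C, by positivity, fun y₁ y₂ hy₁ hy₂ => ?_⟩
  have e : thetaSeries orthoCoord₁ α (h / k) y₁ y₂ = (√3 : ℂ) * ∑' m : ℤ, ∑' j : ℤ,
      ((((α.2 + m) * Real.exp (-Real.pi * (1 / 2 * (α.2 + m) ^ 2 * y₂))) : ℝ) : ℂ) *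
        (qpow (h / k : ℝ) (Q (α.1 + j) (α.2 + m)) * (((2 * j + (2 * α.1 + α.2 + m)) *
          Real.exp (-Real.pi * (3 / 2 * (2 * j + (2 * α.1 + α.2 + m)) ^ 2 * y₁)) : ℝ) : ℂ)) := by
    have hs := summable_thetaTerm orthoCoord₁_sq α (h / k) hy₁ hy₂
    rw [thetaSeries, ← (Equiv.prodComm ℤ ℤ).tsum_eq,
      Summable.tsum_prod (f := fun c => thetaTerm orthoCoord₁ α (h / k) y₁ y₂ (Equiv.prodComm ℤ ℤ c))
        ((Equiv.prodComm ℤ ℤ).summable_iff.2 hs)]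
    simp_rw [← tsum_mul_left]
    refine tsum_congr fun m => tsum_congr fun j => ?_
    simp only [thetaTerm, oddGaussian, orthoCoord₁, Equiv.prodComm_apply, Prod.swap]
    rw [mul_left_comm _ (qpow _ _), mul_left_comm _ (qpow _ _), ← Complex.ofReal_mul,
      ← Complex.ofReal_mul]
    congr 2
    rw [mul_pow, sq_sqrt_three, mul_mul_mul_comm, ← Real.exp_add]
    rw [← mul_assoc √3]
    congr 1
    · ring
    · congr 1; ring
  rw [e, norm_mul, Complex.norm_real, Real.norm_of_nonneg (Real.sqrt_nonneg _), mul_assoc, mul_assoc,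
    ← mul_assoc C]
  exact mul_le_mul_of_nonneg_left (hC y₁ y₂ hy₁ hy₂) (Real.sqrt_nonneg _)

lemma isFlat_thetaSeries₂ {α : ℝ × ℝ} {p : ℕ} (hp : 0 < p) {a₁ a₂ : ℤ} (h₁ : α.1 = a₁ / p)
    (h₂ : α.2 = a₂ / p) (h : ℤ) {k : ℕ} (hk : 0 < k) :
    IsFlat (thetaSeries orthoCoord₂ α (h / k)) := by
  refine ⟨aestronglyMeasurable_thetaSeries orthoCoord₂_sq α _, ?_⟩
  have : NeZero (k * p) := ⟨by positivity⟩
  have hp' : (p : ℝ) ≠ 0 := by positivity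
  have hk' : (k : ℝ) ≠ 0 := by positivity
  obtain ⟨b, hb, H⟩ := norm_tsum_tsum_le (k * p) (c₁ := 1 / 2) (c₂ := 3 / 2) (by norm_num)
    (by norm_num) α.1 (fun m => 2 * α.2 + 3 * (α.1 + m))
    (fun m j => qpow (h / k : ℝ) (Q (α.1 + m) (α.2 + j)))
    (fun m j => qpow_eq_of_mul_eq_add_int
      (h * (3 * a₁ + 3 * p * m + 2 * a₂ + 2 * p * j + p * (k * p))) (by
        simp only [Q, h₁, h₂]; push_cast; field_simp; ring))
    (fun m j => (norm_qpow_ofReal _ _).le)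
  refine ⟨b, hb, fun N => ?_⟩
  obtain ⟨C, hC0, hC⟩ := H N
  refine ⟨√3 * C, by positivity, fun y₁ y₂ hy₁ hy₂ => ?_⟩
  have e : thetaSeries orthoCoord₂ α (h / k) y₁ y₂ = (√3 : ℂ) * ∑' m : ℤ, ∑' j : ℤ,
      ((((α.1 + m) * Real.exp (-Real.pi * (3 / 2 * (α.1 + m) ^ 2 * y₂))) : ℝ) : ℂ) *
        (qpow (h / k : ℝ) (Q (α.1 + m) (α.2 + j)) * (((2 * j + (2 * α.2 + 3 * (α.1 + m))) *
          Real.exp (-Real.pi * (1 / 2 * (2 * j + (2 * α.2 + 3 * (α.1 + m))) ^ 2 * y₁)) : ℝ) :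
            ℂ)) := by
    have hs := summable_thetaTerm orthoCoord₂_sq α (h / k) hy₁ hy₂
    rw [thetaSeries, Summable.tsum_prod hs]
    simp_rw [← tsum_mul_left]
    refine tsum_congr fun m => tsum_congr fun j => ?_
    simp only [thetaTerm, oddGaussian, orthoCoord₂]
    rw [mul_left_comm _ (qpow _ _), mul_left_comm _ (qpow _ _), ← Complex.ofReal_mul,
      ← Complex.ofReal_mul]
    congr 2
    rw [mul_pow √3, sq_sqrt_three, mul_mul_mul_comm, ← Real.exp_add]
    rw [← mul_assoc √3]
    congr 1
    · ring
    · congr 1; ring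
  rw [e, norm_mul, Complex.norm_real, Real.norm_of_nonneg (Real.sqrt_nonneg _), mul_assoc, mul_assoc,
    ← mul_assoc C]
  exact mul_le_mul_of_nonneg_left (hC y₁ y₂ hy₁ hy₂) (Real.sqrt_nonneg _)

/-! ### Termwise integration of the theta series -/

lemma integrableOn_gaussian_div_sqrt {a b : ℝ} (ha : 0 < a) (hb : 0 < b) :
    IntegrableOn (fun z : ℝ × ℝ => Real.exp (-(a * z.1 + b * (z.1 + z.2))) *
      (1 / √z.1 * (1 / √(z.1 + z.2)))) (Ioi 0 ×ˢ Ioi 0) := by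
  have hg := (integrable_expTailSqrt (c := a + b) (by positivity)).mul_prod
    (integrable_expTailSqrt hb)
  refine Integrable.mono' hg.integrableOn (by fun_prop) ?_
  filter_upwards [ae_restrict_mem (measurableSet_Ioi.prod measurableSet_Ioi)] with z hz
  obtain ⟨h1, h2, -⟩ := mem_quadrant hz
  rw [Real.norm_of_nonneg (by positivity), expTailSqrt, expTailSqrt, indicator_of_mem hz.1,
    indicator_of_mem hz.2]
  calc _ ≤ Real.exp (-(a * z.1 + b * (z.1 + z.2))) * (1 / √z.1 * (1 / √z.2)) := by
        refine mul_le_mul_of_nonneg_left (mul_le_mul_of_nonneg_left ?_ (by positivity))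
          (by positivity)
        exact one_div_le_one_div_of_le (Real.sqrt_pos.2 h2) (Real.sqrt_le_sqrt (by linarith))
    _ = 1 / √z.1 * (1 / √z.2) * Real.exp (-(a + b) * z.1 + -b * z.2) := by
        rw [mul_comm]; congr 2; ring
    _ = _ := by rw [Real.exp_add]; ring

lemma hasDerivAt_arctan_div_sqrt {A B : ℝ} (hA : A ≠ 0) (hB : B ≠ 0) {w : ℝ} (hw : 0 ≤ w) :
    HasDerivAt (fun w : ℝ => -(2 / (A * B)) * Real.arctan (A / B * (√(1 + w))⁻¹))
      (1 / (A ^ 2 + B ^ 2 * (1 + w)) * (1 / √(1 + w))) w := by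
  have h1 : 0 < 1 + w := by linarith
  have hs : 0 < √(1 + w) := Real.sqrt_pos.2 h1
  have hsq : √(1 + w) ^ 2 = 1 + w := Real.sq_sqrt h1.le
  have hd := ((((((hasDerivAt_id w).const_add 1).sqrt (by simpa using h1.ne')).inv
    (by simpa using hs.ne')).const_mul (A / B)).arctan).const_mul (-(2 / (A * B)))
  refine hd.congr_deriv ?_
  simp only [id, Pi.inv_apply]
  have hne : A ^ 2 + B ^ 2 * (1 + w) ≠ 0 := by positivity
  have hne' : A ^ 2 + B ^ 2 * √(1 + w) ^ 2 ≠ 0 := by rw [hsq]; exact hne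
  have hne2 : 1 + (A / B * (√(1 + w))⁻¹) ^ 2 =
      (A ^ 2 + B ^ 2 * √(1 + w) ^ 2) / (B ^ 2 * √(1 + w) ^ 2) := by
    field_simp; ring
  rw [hne2]
  rw [← hsq] at hne
  rw [← hsq, Real.sqrt_sq hs.le]
  field_simp

lemma tendsto_arctan_div_sqrt (A B : ℝ) :
    Tendsto (fun w : ℝ => -(2 / (A * B)) * Real.arctan (A / B * (√(1 + w))⁻¹)) atTop (nhds 0) := by
  have h1 : Tendsto (fun w : ℝ => √(1 + w)) atTop atTop :=
    Real.tendsto_sqrt_atTop.comp (tendsto_atTop_add_const_left _ _ tendsto_id)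
  have h2 := (Real.continuous_arctan.tendsto _).comp ((tendsto_inv_atTop_zero.comp h1).const_mul (A / B))
  have h3 := h2.const_mul (-(2 / (A * B)))
  simpa [Function.comp_def] using h3

lemma integrableOn_one_div_mul_one_div_sqrt {A B : ℝ} (hA : A ≠ 0) (hB : B ≠ 0) :
    IntegrableOn (fun w : ℝ => 1 / (A ^ 2 + B ^ 2 * (1 + w)) * (1 / √(1 + w))) (Ioi 0) :=
  integrableOn_Ioi_deriv_of_nonneg' (fun w hw => hasDerivAt_arctan_div_sqrt hA hB hw)
    (fun w hw => by have : 0 < w := hw; positivity) (tendsto_arctan_div_sqrt A B)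

lemma integral_one_div_mul_one_div_sqrt {A B : ℝ} (hA : A ≠ 0) (hB : B ≠ 0) :
    ∫ w in Ioi (0 : ℝ), 1 / (A ^ 2 + B ^ 2 * (1 + w)) * (1 / √(1 + w)) =
      2 / (A * B) * Real.arctan (A / B) := by
  rw [integral_Ioi_of_hasDerivAt_of_tendsto
    (hasDerivAt_arctan_div_sqrt hA hB le_rfl).continuousAt.continuousWithinAt
    (fun w hw => hasDerivAt_arctan_div_sqrt hA hB (le_of_lt hw))
    (integrableOn_one_div_mul_one_div_sqrt hA hB) (tendsto_arctan_div_sqrt A B)]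
  simp

lemma integrableOn_exp_mul_one_div_sqrt_prod {A B c : ℝ} (hc : 0 < c) (hA : A ≠ 0) (hB : B ≠ 0) :
    Integrable (Function.uncurry fun u w : ℝ =>
      Real.exp (-(c * (A ^ 2 + B ^ 2 * (1 + w))) * u) * (1 / √(1 + w)))
      ((volume.restrict (Ioi 0)).prod (volume.restrict (Ioi 0))) := by
  have hκ : ∀ w : ℝ, 0 < w → 0 < c * (A ^ 2 + B ^ 2 * (1 + w)) := fun w hw => by positivity
  rw [integrable_prod_iff' (Measurable.aestronglyMeasurable (by unfold Function.uncurry; fun_prop))]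
  constructor
  · filter_upwards [ae_restrict_mem measurableSet_Ioi] with w hw
    exact (integrableOn_exp_mul_Ioi (neg_lt_zero.2 (hκ w hw)) 0).mul_const (1 / √(1 + w))
  · refine ((integrableOn_one_div_mul_one_div_sqrt hA hB).const_mul c⁻¹).congr ?_
    filter_upwards [ae_restrict_mem measurableSet_Ioi] with w hw
    have hw : 0 < w := hw
    have := hκ w hw
    simp only [Function.uncurry]
    simp_rw [norm_mul, Real.norm_eq_abs, Real.abs_exp]
    rw [integral_mul_const, integral_exp_mul_Ioi (neg_lt_zero.2 (hκ w hw)),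
      abs_of_nonneg (by positivity)]
    simp only [mul_zero, Real.exp_zero]
    field_simp

/-- Scaling `v = u w` in the inner variable and interchanging the integrals leaves an elementary
integral. -/
lemma integral_gaussian_div_sqrt {A B c : ℝ} (hc : 0 < c) (hA : A ≠ 0) (hB : B ≠ 0) :
    ∫ z in Ioi (0 : ℝ) ×ˢ Ioi (0 : ℝ), Real.exp (-(c * A ^ 2 * z.1 + c * B ^ 2 * (z.1 + z.2))) *
      (1 / √z.1 * (1 / √(z.1 + z.2))) = 2 / (c * (A * B)) * Real.arctan (A / B) := by
  have hint := integrableOn_gaussian_div_sqrt (a := c * A ^ 2) (b := c * B ^ 2) (by positivity)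
    (by positivity)
  rw [Measure.volume_eq_prod] at hint ⊢
  rw [setIntegral_prod _ hint]
  have h1 : ∀ u ∈ Ioi (0 : ℝ), ∫ v in Ioi (0 : ℝ),
      Real.exp (-(c * A ^ 2 * u + c * B ^ 2 * (u + v))) * (1 / √u * (1 / √(u + v))) =
      ∫ w in Ioi (0 : ℝ), Real.exp (-(c * (A ^ 2 + B ^ 2 * (1 + w))) * u) * (1 / √(1 + w)) := by
    intro u hu
    have hu : 0 < u := hu
    have := integral_comp_mul_left_Ioi (fun v =>
      Real.exp (-(c * A ^ 2 * u + c * B ^ 2 * (u + v))) * (1 / √u * (1 / √(u + v)))) 0 hu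
    rw [mul_zero, smul_eq_mul, eq_inv_mul_iff_mul_eq₀ hu.ne'] at this
    rw [← this, ← integral_const_mul]
    refine setIntegral_congr_fun measurableSet_Ioi fun w hw => ?_
    have hw : 0 < w := hw
    rw [show u + u * w = u * (1 + w) by ring, Real.sqrt_mul hu.le]
    have hsq : √u * √u = u := Real.mul_self_sqrt hu.le
    have hs : 0 < √u := Real.sqrt_pos.2 hu
    have hs' : 0 < √(1 + w) := Real.sqrt_pos.2 (by linarith)
    rw [show -(c * A ^ 2 * u + c * B ^ 2 * (u * (1 + w))) = -(c * (A ^ 2 + B ^ 2 * (1 + w))) * u by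
      ring, mul_left_comm]
    congr 1
    rw [← one_div_mul_one_div, ← mul_assoc (1 / √u), div_mul_div_comm, hsq]
    field_simp
  rw [setIntegral_congr_fun measurableSet_Ioi h1,
    integral_integral_swap (integrableOn_exp_mul_one_div_sqrt_prod hc hA hB)]
  have h2 : ∀ w ∈ Ioi (0 : ℝ), ∫ u in Ioi (0 : ℝ),
      Real.exp (-(c * (A ^ 2 + B ^ 2 * (1 + w))) * u) * (1 / √(1 + w)) =
      c⁻¹ * (1 / (A ^ 2 + B ^ 2 * (1 + w)) * (1 / √(1 + w))) := by
    intro w hw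
    have hw : 0 < w := hw
    have hκ : 0 < c * (A ^ 2 + B ^ 2 * (1 + w)) := by positivity
    rw [integral_mul_const, integral_exp_mul_Ioi (neg_lt_zero.2 hκ)]
    simp only [mul_zero, Real.exp_zero]
    field_simp
  rw [setIntegral_congr_fun measurableSet_Ioi h2, integral_const_mul,
    integral_one_div_mul_one_div_sqrt hA hB]
  field_simp

lemma integrableOn_oddGaussian_div_sqrt (A B : ℝ) :
    IntegrableOn (fun z : ℝ × ℝ => oddGaussian A B z.1 (z.1 + z.2) *
      (1 / √z.1 * (1 / √(z.1 + z.2)))) (Ioi 0 ×ˢ Ioi 0) := by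
  have hπ := Real.pi_pos
  rcases eq_or_ne A 0 with rfl | hA
  · simp [oddGaussian]
  rcases eq_or_ne B 0 with rfl | hB
  · simp [oddGaussian]
  have h := (integrableOn_gaussian_div_sqrt (a := Real.pi / 2 * A ^ 2) (b := Real.pi / 2 * B ^ 2)
    (by positivity) (by positivity)).const_mul (A * B)
  refine IntegrableOn.congr_fun h (fun z _ => ?_) (measurableSet_Ioi.prod measurableSet_Ioi)
  simp only [oddGaussian]
  rw [← mul_assoc]
  congr 3; ring

/-- The double integral of the odd Gaussian; for `B = 0` both sides vanish. -/
lemma integral_oddGaussian_div_sqrt (A B : ℝ) :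
    ∫ z in Ioi (0 : ℝ) ×ˢ Ioi (0 : ℝ), oddGaussian A B z.1 (z.1 + z.2) *
      (1 / √z.1 * (1 / √(z.1 + z.2))) = 4 / Real.pi * Real.arctan (A / B) := by
  have hπ := Real.pi_pos
  rcases eq_or_ne A 0 with rfl | hA
  · simp [oddGaussian]
  rcases eq_or_ne B 0 with rfl | hB
  · simp [oddGaussian]
  have h := integral_gaussian_div_sqrt (c := Real.pi / 2) (by positivity) hA hB
  have h2 : ∀ z : ℝ × ℝ, oddGaussian A B z.1 (z.1 + z.2) * (1 / √z.1 * (1 / √(z.1 + z.2))) =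
      A * B * (Real.exp (-(Real.pi / 2 * A ^ 2 * z.1 + Real.pi / 2 * B ^ 2 * (z.1 + z.2))) *
        (1 / √z.1 * (1 / √(z.1 + z.2)))) := fun z => by
    simp only [oddGaussian]
    rw [← mul_assoc (A * B)]
    congr 3; ring
  simp_rw [h2]
  rw [integral_const_mul, h]
  field_simp
  norm_num

/-- Translation by `ε` in the first variable removes the cut-off of the kernel. -/
lemma indicator_mul_eichlerKernel {ε : ℝ} (hε : 0 < ε) (A B : ℝ) (z : ℝ × ℝ) :
    indicator (Ioi (0 : ℝ) ×ˢ Ioi (0 : ℝ)) (fun z : ℝ × ℝ => oddGaussian A B z.1 (z.1 + z.2) *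
      eichlerKernel ε z.1 (z.1 + z.2)) (z + (ε, 0)) =
    Real.exp (-(Real.pi / 2) * (A ^ 2 + B ^ 2) * ε) *
      indicator (Ioi (0 : ℝ) ×ˢ Ioi (0 : ℝ)) (fun z : ℝ × ℝ => oddGaussian A B z.1 (z.1 + z.2) *
        (1 / √z.1 * (1 / √(z.1 + z.2)))) z := by
  obtain ⟨u, v⟩ := z
  by_cases hz : (u, v) ∈ Ioi (0 : ℝ) ×ˢ Ioi (0 : ℝ)
  · obtain ⟨hu : 0 < u, hv : 0 < v⟩ := hz
    rw [indicator_of_mem (show (u, v) ∈ Ioi (0 : ℝ) ×ˢ Ioi (0 : ℝ) from ⟨hu, hv⟩),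
      indicator_of_mem (show (u, v) + (ε, 0) ∈ Ioi (0 : ℝ) ×ˢ Ioi (0 : ℝ) from
        ⟨show 0 < u + ε by positivity, show 0 < v + 0 by simpa using hv⟩)]
    simp only [Prod.mk_add_mk, add_zero, eichlerKernel]
    rw [if_pos (by rw [abs_of_pos hε]; linarith), ← mul_assoc _ (oddGaussian A B u (u + v)),
      add_sub_cancel_right, show u + ε + v - ε = u + v by ring]
    congr 1
    simp only [oddGaussian]
    rw [mul_left_comm, ← Real.exp_add]
    congr 2
    ring
  · rw [indicator_of_notMem hz, mul_zero, indicator_apply_eq_zero]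
    rintro ⟨-, h2⟩
    have h2 : 0 < v + 0 := h2
    have hu : ¬ 0 < u := fun hu => hz ⟨hu, show 0 < v by simpa using h2⟩
    simp only [Prod.mk_add_mk, eichlerKernel]
    rw [if_neg (by rw [abs_of_pos hε]; intro h; exact hu (by linarith)), mul_zero]

lemma integrableOn_oddGaussian_mul_eichlerKernel {ε : ℝ} (hε : 0 < ε) (A B : ℝ) :
    IntegrableOn (fun z : ℝ × ℝ => oddGaussian A B z.1 (z.1 + z.2) *
      eichlerKernel ε z.1 (z.1 + z.2)) (Ioi 0 ×ˢ Ioi 0) := by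
  have hm : MeasurableSet (Ioi (0 : ℝ) ×ˢ Ioi (0 : ℝ)) := measurableSet_Ioi.prod measurableSet_Ioi
  have h := ((integrable_indicator_iff hm).2 (integrableOn_oddGaussian_div_sqrt A B)).const_mul
    (Real.exp (-(Real.pi / 2) * (A ^ 2 + B ^ 2) * ε))
  simp_rw [← indicator_mul_eichlerKernel hε] at h
  have h' := h.comp_add_right ((-ε, 0) : ℝ × ℝ)
  rw [← integrable_indicator_iff hm]
  refine h'.congr (Eventually.of_forall fun z => ?_)
  beta_reduce
  rw [add_assoc, show ((-ε, 0) : ℝ × ℝ) + (ε, 0) = 0 by ext <;> simp, add_zero]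

lemma integral_oddGaussian_mul_eichlerKernel {ε : ℝ} (hε : 0 < ε) (A B : ℝ) :
    ∫ z in Ioi (0 : ℝ) ×ˢ Ioi (0 : ℝ), oddGaussian A B z.1 (z.1 + z.2) *
      eichlerKernel ε z.1 (z.1 + z.2) =
    Real.exp (-(Real.pi / 2) * (A ^ 2 + B ^ 2) * ε) * (4 / Real.pi * Real.arctan (A / B)) := by
  have hm : MeasurableSet (Ioi (0 : ℝ) ×ˢ Ioi (0 : ℝ)) := measurableSet_Ioi.prod measurableSet_Ioi
  rw [← integral_indicator hm, ← integral_add_right_eq_self _ ((ε, 0) : ℝ × ℝ)]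
  simp_rw [indicator_mul_eichlerKernel hε]
  rw [integral_const_mul, integral_indicator hm, integral_oddGaussian_div_sqrt]

/-- The Eichler integral of a theta series at `s = ε > 0`, integrated termwise. -/
lemma hasSum_eichlerIntegral_thetaSeries {L : ℝ → ℝ → ℝ × ℝ}
    (hL : ∀ x y, (L x y).1 ^ 2 + (L x y).2 ^ 2 = 4 * Q x y) (α : ℝ × ℝ) (x : ℝ) {ε : ℝ}
    (hε : 0 < ε) :
    HasSum (fun n : ℤ × ℤ => qpow x (Q (α.1 + n.1) (α.2 + n.2)) *
      ((Real.exp (-(2 * Real.pi * ε) * Q (α.1 + n.1) (α.2 + n.2)) * (4 / Real.pi *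
        Real.arctan ((L (α.1 + n.1) (α.2 + n.2)).1 / (L (α.1 + n.1) (α.2 + n.2)).2)) : ℝ) : ℂ))
      (eichlerIntegral (thetaSeries L α x) ε) := by
  have hπ := Real.pi_pos
  set A : ℤ × ℤ → ℝ := fun n => (L (α.1 + n.1) (α.2 + n.2)).1 with hA
  set B : ℤ × ℤ → ℝ := fun n => (L (α.1 + n.1) (α.2 + n.2)).2 with hB
  have hexp : ∀ n, -(Real.pi / 2) * (A n ^ 2 + B n ^ 2) * ε =
      -(2 * Real.pi * ε) * Q (α.1 + n.1) (α.2 + n.2) := fun n => by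
    rw [hA, hB]; simp only [hL]; ring
  have hint : ∀ n, IntegrableOn (fun z : ℝ × ℝ => thetaTerm L α x z.1 (z.1 + z.2) n *
      (eichlerKernel ε z.1 (z.1 + z.2) : ℂ)) (Ioi 0 ×ˢ Ioi 0) := fun n => by
    refine (((integrableOn_oddGaussian_mul_eichlerKernel hε (A n) (B n)).ofReal
      (𝕜 := ℂ)).const_mul (qpow x (Q (α.1 + n.1) (α.2 + n.2)))).congr
      (Eventually.of_forall fun z => ?_)
    simp [thetaTerm, mul_assoc, hA, hB]
  have hK0 : ∀ z ∈ Ioi (0 : ℝ) ×ˢ Ioi (0 : ℝ), 0 ≤ eichlerKernel ε z.1 (z.1 + z.2) := fun z _ => by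
    rw [eichlerKernel]; split_ifs <;> positivity
  have hnorm : ∀ n, ∫ z in Ioi (0 : ℝ) ×ˢ Ioi (0 : ℝ), ‖thetaTerm L α x z.1 (z.1 + z.2) n *
      (eichlerKernel ε z.1 (z.1 + z.2) : ℂ)‖ =
      Real.exp (-(2 * Real.pi * ε) * Q (α.1 + n.1) (α.2 + n.2)) *
        (4 / Real.pi * Real.arctan (|A n| / |B n|)) := fun n => by
    rw [← hexp, ← sq_abs (A n), ← sq_abs (B n), ← integral_oddGaussian_mul_eichlerKernel hε]
    refine setIntegral_congr_fun (measurableSet_Ioi.prod measurableSet_Ioi) fun z hz => ?_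
    simp only [thetaTerm]
    rw [norm_mul, norm_mul, norm_qpow_ofReal, one_mul, Complex.norm_real, Complex.norm_real,
      Real.norm_of_nonneg (hK0 z hz), Real.norm_eq_abs]
    congr 1
    simp only [oddGaussian, abs_mul, Real.abs_exp, sq_abs, hA, hB]
  have hsum : Summable fun n => ∫ z in Ioi (0 : ℝ) ×ˢ Ioi (0 : ℝ),
      ‖thetaTerm L α x z.1 (z.1 + z.2) n * (eichlerKernel ε z.1 (z.1 + z.2) : ℂ)‖ := by
    refine Summable.of_nonneg_of_le (fun n => integral_nonneg fun z => norm_nonneg _) (fun n => ?_)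
      ((summable_exp_neg_Q α (c := 2 * Real.pi * ε) (by positivity)).mul_right 2)
    rw [hnorm]
    refine mul_le_mul_of_nonneg_left ?_ (by positivity)
    have := Real.arctan_lt_pi_div_two (|A n| / |B n|)
    calc _ ≤ 4 / Real.pi * (Real.pi / 2) := by gcongr
      _ = 2 := by field_simp; norm_num
  have h := hasSum_integral_of_summable_integral_norm hint hsum
  have e₁ : ∫ z in Ioi (0 : ℝ) ×ˢ Ioi (0 : ℝ), ∑' n, thetaTerm L α x z.1 (z.1 + z.2) n *
      (eichlerKernel ε z.1 (z.1 + z.2) : ℂ) = eichlerIntegral (thetaSeries L α x) ε := by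
    simp_rw [tsum_mul_right]
    rfl
  have e₂ : ∀ n, ∫ z in Ioi (0 : ℝ) ×ˢ Ioi (0 : ℝ), thetaTerm L α x z.1 (z.1 + z.2) n *
      (eichlerKernel ε z.1 (z.1 + z.2) : ℂ) = qpow x (Q (α.1 + n.1) (α.2 + n.2)) *
      ((Real.exp (-(2 * Real.pi * ε) * Q (α.1 + n.1) (α.2 + n.2)) * (4 / Real.pi *
        Real.arctan (A n / B n)) : ℝ) : ℂ) := fun n => by
    rw [← hexp, ← integral_oddGaussian_mul_eichlerKernel hε, ← integral_complex_ofReal,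
      ← integral_const_mul]
    refine integral_congr_ae (Eventually.of_forall fun z => ?_)
    simp [thetaTerm, mul_assoc, hA, hB]
  rw [e₁] at h
  simpa only [e₂] using h

/-- The two angles of a lattice vector with respect to its orthogonal coordinates add up to a
constant on each pair of opposite quadrants. -/
lemma arctan_add_arctan_eq {x y : ℝ} (h : x ≠ 0 ∨ y ≠ 0) :
    Real.arctan ((orthoCoord₁ x y).1 / (orthoCoord₁ x y).2) +
      Real.arctan ((orthoCoord₂ x y).1 / (orthoCoord₂ x y).2) =
    Real.pi / 3 + Real.pi / 2 * (Real.sign x * Real.sign y) := by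
  have h3 : 0 < √(3 : ℝ) := Real.sqrt_pos.2 (by norm_num)
  have h33 : √3 * √3 = (3 : ℝ) := Real.mul_self_sqrt (by norm_num)
  simp only [orthoCoord₁, orthoCoord₂]
  rcases eq_or_ne y 0 with rfl | hy
  · have hx : x ≠ 0 := by simpa using h
    have : (3 * x + 2 * 0) / (√3 * x) = √3 := by field_simp; rw [sq_sqrt_three]; ring
    rw [this]
    simp
  rcases eq_or_ne x 0 with rfl | hx
  · have : √3 * (2 * 0 + y) / y = √3 := by field_simp; ring
    rw [this]
    simp
  set X := √3 * (2 * x + y) / y with hX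
  set Z := (3 * x + 2 * y) / (√3 * x) with hZ
  have hD : 0 < 6 * x ^ 2 + 6 * x * y + 2 * y ^ 2 := by
    have : 0 < y ^ 2 := by positivity
    nlinarith [sq_nonneg (2 * x + y)]
  have hXZ : 1 - X * Z = -((6 * x ^ 2 + 6 * x * y + 2 * y ^ 2) / (x * y)) := by
    rw [hX, hZ]; field_simp; ring
  have hsum : (X + Z) / (1 - X * Z) = -(√3)⁻¹ := by
    have e : X + Z = (6 * x ^ 2 + 6 * x * y + 2 * y ^ 2) / (x * y) * (√3)⁻¹ := by
      rw [hX, hZ]; field_simp; rw [sq_sqrt_three]; ring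
    have hne : (6 * x ^ 2 + 6 * x * y + 2 * y ^ 2) / (x * y) ≠ 0 :=
      div_ne_zero hD.ne' (mul_ne_zero hx hy)
    rw [hXZ, e, div_neg, mul_div_cancel_left₀ _ hne]
  rcases lt_or_gt_of_ne (mul_ne_zero hx hy) with hxy | hxy
  · have hlt : X * Z < 1 := by
      have : (6 * x ^ 2 + 6 * x * y + 2 * y ^ 2) / (x * y) < 0 := div_neg_of_pos_of_neg hD hxy
      linarith
    have hs : Real.sign x * Real.sign y = -1 := by
      rcases mul_neg_iff.1 hxy with ⟨a, b⟩ | ⟨a, b⟩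
      · rw [Real.sign_of_pos a, Real.sign_of_neg b]; norm_num
      · rw [Real.sign_of_neg a, Real.sign_of_pos b]; norm_num
    rw [Real.arctan_add hlt, hsum, hs, Real.arctan_neg, Real.arctan_inv_sqrt_three]
    ring
  · have hgt : 1 < X * Z := by
      have : 0 < (6 * x ^ 2 + 6 * x * y + 2 * y ^ 2) / (x * y) := div_pos hD hxy
      linarith
    have hX0 : 0 < X := by
      have : X = √3 * (2 * (x * y) + y ^ 2) / y ^ 2 := by rw [hX]; field_simp
      rw [this]; positivity
    have hs : Real.sign x * Real.sign y = 1 := by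
      rcases mul_pos_iff.1 hxy with ⟨a, b⟩ | ⟨a, b⟩
      · rw [Real.sign_of_pos a, Real.sign_of_pos b]; norm_num
      · rw [Real.sign_of_neg a, Real.sign_of_neg b]; norm_num
    rw [Real.arctan_add_eq_add_pi hgt hX0, hsum, hs, Real.arctan_neg, Real.arctan_inv_sqrt_three]
    ring

/-! ### The false theta series in full lattice form -/

/-- The value `q ^ Q(α + n)`. -/
noncomputable def qForm (τ : ℂ) (α : ℝ × ℝ) (n : ℤ × ℤ) : ℂ := qpow τ (Q (α.1 + n.1) (α.2 + n.2))

/-- The sign of the integer `n`, with `0` counted as positive. -/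
def intSign (n : ℤ) : ℝ := if 0 ≤ n then 1 else -1

lemma norm_qpow (τ : ℂ) (r : ℝ) : ‖qpow τ r‖ = Real.exp (-(2 * Real.pi * τ.im) * r) := by
  rw [qpow, Complex.norm_exp]
  congr 1
  simp

lemma summable_qForm {τ : ℂ} (hτ : 0 < τ.im) (α : ℝ × ℝ) : Summable (qForm τ α) := by
  refine Summable.of_norm_bounded (summable_exp_neg_Q α (c := 2 * Real.pi * τ.im)
    (by have := Real.pi_pos; positivity)) fun n => ?_
  rw [qForm, norm_qpow]

lemma summable_mul_qForm {τ : ℂ} (hτ : 0 < τ.im) (α : ℝ × ℝ) {c : ℤ × ℤ → ℝ}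
    (hc : ∀ n, |c n| ≤ 1) : Summable fun n => (c n : ℂ) * qForm τ α n := by
  refine Summable.of_norm_bounded (summable_qForm hτ α).norm fun n => ?_
  rw [norm_mul, Complex.norm_real, Real.norm_eq_abs]
  exact mul_le_of_le_one_left (norm_nonneg _) (hc n)

lemma abs_intSign (n : ℤ) : |intSign n| = 1 := by
  rw [intSign]; split_ifs <;> simp

lemma abs_intSign_mul_le (n : ℤ × ℤ) : |intSign n.1 * intSign n.2| ≤ 1 := by
  rw [abs_mul, abs_intSign, abs_intSign, one_mul]

lemma abs_sign_le (x : ℝ) : |Real.sign x| ≤ 1 := by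
  rcases Real.sign_apply_eq x with h | h | h <;> rw [h] <;> norm_num

lemma abs_sign_mul_le (x y : ℝ) : |Real.sign x * Real.sign y| ≤ 1 := by
  rw [abs_mul]
  exact mul_le_one₀ (abs_sign_le x) (abs_nonneg _) (abs_sign_le y)

lemma intSign_eq_sign {a : ℝ} (h0 : 0 < a) (h1 : a < 1) (n : ℤ) :
    intSign n = Real.sign (a + n) := by
  rw [intSign]
  split_ifs with h
  · have : (0 : ℝ) ≤ n := by exact_mod_cast h
    rw [Real.sign_of_pos (by linarith)]
  · have : (n : ℝ) ≤ -1 := by exact_mod_cast (by omega : n ≤ -1)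
    rw [Real.sign_of_neg (by linarith)]

/-- The quadrant sums of two complementary shifts cover two opposite quadrants of one lattice
coset, because `Q` is even. -/
lemma tsum_quadrant_add_tsum_quadrant {τ : ℂ} (hτ : 0 < τ.im) (α β : ℝ × ℝ)
    (h₁ : β.1 = 1 - α.1) (h₂ : β.2 = 1 - α.2) :
    ∑' n : ℕ × ℕ, qpow τ (Q (α.1 + n.1) (α.2 + n.2)) +
      ∑' n : ℕ × ℕ, qpow τ (Q (β.1 + n.1) (β.2 + n.2)) =
    1 / 2 * (∑' n, qForm τ α n + ∑' n, ((intSign n.1 * intSign n.2 : ℝ) : ℂ) * qForm τ α n) := by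
  let f : ℤ × ℤ → ℂ := fun n => ((if 0 ≤ n.1 ∧ 0 ≤ n.2 then 1 else 0 : ℝ) : ℂ) * qForm τ α n
  let g : ℤ × ℤ → ℂ := fun n => ((if n.1 < 0 ∧ n.2 < 0 then 1 else 0 : ℝ) : ℂ) * qForm τ α n
  let i : ℕ × ℕ → ℤ × ℤ := fun n => (n.1, n.2)
  let j : ℕ × ℕ → ℤ × ℤ := fun n => (-1 - n.1, -1 - n.2)
  have hi : Function.Injective i := fun a b h => by
    simp only [i, Prod.mk.injEq, Nat.cast_inj] at h
    exact Prod.ext h.1 h.2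
  have hj : Function.Injective j := fun a b h => by
    simp only [j, Prod.mk.injEq] at h
    exact Prod.ext (by omega) (by omega)
  have hfi : Function.support f ⊆ range i := fun n hn => by
    by_cases h : 0 ≤ n.1 ∧ 0 ≤ n.2
    · exact ⟨(n.1.toNat, n.2.toNat), Prod.ext (Int.toNat_of_nonneg h.1) (Int.toNat_of_nonneg h.2)⟩
    · exact absurd (show f n = 0 by simp only [f]; rw [if_neg h]; simp) hn
  have hgj : Function.support g ⊆ range j := fun n hn => by
    by_cases h : n.1 < 0 ∧ n.2 < 0
    · refine ⟨((-1 - n.1).toNat, (-1 - n.2).toNat), Prod.ext ?_ ?_⟩ <;> simp only [j] <;> omega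
    · exact absurd (show g n = 0 by simp only [g]; rw [if_neg h]; simp) hn
  have e₁ : ∑' n : ℕ × ℕ, qpow τ (Q (α.1 + n.1) (α.2 + n.2)) = ∑' n, f n := by
    rw [← hi.tsum_eq hfi]
    refine tsum_congr fun n => ?_
    simp [f, i, qForm]
  have e₂ : ∑' n : ℕ × ℕ, qpow τ (Q (β.1 + n.1) (β.2 + n.2)) = ∑' n, g n := by
    rw [← hj.tsum_eq hgj]
    refine tsum_congr fun n => ?_
    simp only [g, j, qForm]
    rw [if_pos (by constructor <;> omega), Complex.ofReal_one, one_mul]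
    congr 1
    simp only [Q, h₁, h₂]; push_cast; ring
  have hf : Summable f := summable_mul_qForm hτ α fun n => by split_ifs <;> norm_num
  have hg : Summable g := summable_mul_qForm hτ α fun n => by split_ifs <;> norm_num
  rw [e₁, e₂, ← hf.tsum_add hg, ← (summable_qForm hτ α).tsum_add
    (summable_mul_qForm hτ α abs_intSign_mul_le), ← tsum_mul_left]
  refine tsum_congr fun n => ?_
  simp only [f, g, intSign]
  split_ifs <;> first | omega | (push_cast; ring)

/-- The three shifts are the images of one another under automorphisms of the form `Q`, up to
lattice vectors; hence they have the same theta series. -/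
lemma tsum_qForm_shiftStar_zero (p : ℕ) (τ : ℂ) :
    ∑' n, qForm τ (shiftStar p 0) n = ∑' n, qForm τ (shiftStar p 2) n := by
  -- The automorphism `(x, y) ↦ (-x, 3 x + y)` of `Q`.
  let e : ℤ × ℤ ≃ ℤ × ℤ :=
    { toFun := fun n => (-1 - n.1, 1 + 3 * n.1 + n.2)
      invFun := fun n => (-1 - n.1, 2 + 3 * n.1 + n.2)
      left_inv := fun n => Prod.ext (by dsimp only; ring) (by dsimp only; ring)
      right_inv := fun n => Prod.ext (by dsimp only; ring) (by dsimp only; ring) }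
  rw [← e.tsum_eq]
  refine tsum_congr fun n => ?_
  simp only [e, Equiv.coe_fn_mk, qForm, shiftStar, Q]
  congr 1
  simp
  ring

lemma tsum_qForm_shiftStar_one (p : ℕ) (τ : ℂ) :
    ∑' n, qForm τ (shiftStar p 1) n = ∑' n, qForm τ (shiftStar p 2) n := by
  -- The automorphism `(x, y) ↦ (-x - y, y)` of `Q`.
  let e : ℤ × ℤ ≃ ℤ × ℤ :=
    { toFun := fun n => (-1 - n.1 - n.2, n.2)
      invFun := fun n => (-1 - n.1 - n.2, n.2)
      left_inv := fun n => Prod.ext (by dsimp only; ring) rfl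
      right_inv := fun n => Prod.ext (by dsimp only; ring) rfl }
  rw [← e.tsum_eq]
  refine tsum_congr fun n => ?_
  simp only [e, Equiv.coe_fn_mk, qForm, shiftStar, Q]
  congr 1
  simp
  ring

/-- The false theta series of rank two of a lattice coset. -/
noncomputable def falseTheta (τ : ℂ) (α : ℝ × ℝ) : ℂ :=
  ∑' n : ℤ × ℤ, ((Real.sign (α.1 + n.1) * Real.sign (α.2 + n.2) : ℝ) : ℂ) * qForm τ α n

lemma tsum_intSign_eq_falseTheta {τ : ℂ} {α : ℝ × ℝ} (h₁ : 0 < α.1) (h₁' : α.1 < 1)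
    (h₂ : 0 < α.2) (h₂' : α.2 < 1) :
    ∑' n, ((intSign n.1 * intSign n.2 : ℝ) : ℂ) * qForm τ α n = falseTheta τ α := by
  refine tsum_congr fun n => ?_
  rw [intSign_eq_sign h₁ h₁', intSign_eq_sign h₂ h₂']

/-- For the shift `(1/2, 1)` the lattice points on the axis `n₂ = 0` cancel in pairs. -/
lemma tsum_intSign_eq_falseTheta_half {τ : ℂ} (hτ : 0 < τ.im) :
    ∑' n, ((intSign n.1 * intSign n.2 : ℝ) : ℂ) * qForm τ (1 / 2, 1) n =
      falseTheta τ (1 / 2, 1) := by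
  have hs₁ := summable_mul_qForm hτ (1 / 2, 1) abs_intSign_mul_le
  have hs₂ := summable_mul_qForm hτ (1 / 2, 1) fun n : ℤ × ℤ =>
    abs_sign_mul_le ((1 / 2 : ℝ) + n.1) (1 + n.2)
  rw [← sub_eq_zero, falseTheta, ← hs₁.tsum_sub hs₂]
  let e : ℤ × ℤ ≃ ℤ × ℤ := Equiv.prodCongr (Equiv.subLeft (-1)) (Equiv.refl ℤ)
  set g : ℤ × ℤ → ℂ := fun n => ((intSign n.1 * intSign n.2 : ℝ) : ℂ) * qForm τ (1 / 2, 1) n -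
    ((Real.sign (1 / 2 + n.1) * Real.sign (1 + n.2) : ℝ) : ℂ) * qForm τ (1 / 2, 1) n with hg
  have hodd : ∀ n, g (e n) = -g n := by
    rintro ⟨a, b⟩
    have hσ : intSign (-1 - a) = -intSign a := by
      simp only [intSign]; split_ifs <;> first | omega | norm_num
    simp only [hg, e, Equiv.prodCongr_apply, Prod.map, Equiv.subLeft_apply, Equiv.refl_apply,
      ← intSign_eq_sign (a := 1 / 2) (by norm_num) (by norm_num), hσ]
    rcases eq_or_ne b (-1) with rfl | hb
    · have : qForm τ (1 / 2, 1) (-1 - a, -1) = qForm τ (1 / 2, 1) (a, -1) := by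
        simp only [qForm, Q]; congr 1; push_cast; ring
      rw [this]; push_cast; ring
    · have : intSign b = Real.sign (1 + b) := by
        rw [intSign]
        split_ifs with h
        · have : (0 : ℝ) ≤ b := by exact_mod_cast h
          rw [Real.sign_of_pos (by linarith)]
        · have : (b : ℝ) ≤ -2 := by exact_mod_cast (by omega : b ≤ -2)
          rw [Real.sign_of_neg (by linarith)]
      rw [this]; simp
  have h := e.tsum_eq g
  simp_rw [hodd, tsum_neg] at h
  exact self_eq_neg.1 h.symm

/-- For the shift `(0, b)` the lattice points on the axis `n₁ = 0` contribute a one-dimensional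
false theta series. -/
lemma tsum_intSign_eq_falseTheta_add {τ : ℂ} (hτ : 0 < τ.im) {b : ℝ} (h0 : 0 < b) (h1 : b < 1) :
    ∑' n, ((intSign n.1 * intSign n.2 : ℝ) : ℂ) * qForm τ (0, b) n =
      falseTheta τ (0, b) - ∑' m : ℤ, (Real.sign (m + (1 - b)) : ℂ) *
        qpow τ ((m + (1 - b)) ^ 2) := by
  have hs₁ := summable_mul_qForm hτ (0, b) abs_intSign_mul_le
  have hs₂ := summable_mul_qForm hτ (0, b) fun n : ℤ × ℤ => abs_sign_mul_le ((0 : ℝ) + n.1) (b + n.2)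
  rw [sub_eq_add_neg, ← sub_eq_iff_eq_add', falseTheta, ← hs₁.tsum_sub hs₂]
  set g : ℤ × ℤ → ℂ := fun n => ((intSign n.1 * intSign n.2 : ℝ) : ℂ) * qForm τ (0, b) n -
    ((Real.sign (0 + n.1) * Real.sign (b + n.2) : ℝ) : ℂ) * qForm τ (0, b) n with hg
  let i : ℤ → ℤ × ℤ := fun m => (0, -1 - m)
  have hi : Function.Injective i := fun a b h => by
    simp only [i, Prod.mk.injEq, true_and] at h; omega
  have hsupp : Function.support g ⊆ range i := fun n hn => by
    by_cases h : n.1 = 0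
    · exact ⟨-1 - n.2, Prod.ext h.symm (by simp [i])⟩
    · refine absurd ?_ hn
      have : intSign n.1 = Real.sign (0 + n.1) := by
        rw [intSign, zero_add]
        split_ifs with h'
        · rw [Real.sign_of_pos (by exact_mod_cast lt_of_le_of_ne h' (Ne.symm h))]
        · rw [Real.sign_of_neg (by exact_mod_cast not_le.1 h')]
      simp only [hg]
      rw [this, intSign_eq_sign h0 h1, sub_self]
  rw [← hi.tsum_eq hsupp, ← tsum_neg]
  refine tsum_congr fun m => ?_
  have hq : qForm τ (0, b) (i m) = qpow τ ((m + (1 - b)) ^ 2) := by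
    simp only [qForm, Q, i]; congr 1; push_cast; ring
  have hs : intSign (-1 - m) = -Real.sign (m + (1 - b)) := by
    rw [intSign_eq_sign h0 h1, ← Real.sign_neg]; congr 1; push_cast; ring
  simp only [hg, hq]
  simp only [i, hs]
  simp [intSign]

/-- `F₁` as a combination of full false theta series: the theta series with constant sign, which
enter with total weight `-2 + 1 + 1 = 0`, cancel. -/
lemma F1_eq_sum_falseTheta {p : ℕ} (hp : 2 ≤ p) {τ : ℂ} (hτ : 0 < τ.im) :
    F1 p τ = ∑ j, shiftStarWeight j * (1 / 2 * falseTheta τ (shiftStar p j)) := by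
  have hp0 : (0 : ℝ) < p := by positivity
  have hp2 : (2 : ℝ) ≤ p := by exact_mod_cast hp
  have hinv0 : 0 < 1 / (p : ℝ) := by positivity
  have hinv1 : 1 / (p : ℝ) ≤ 1 / 2 := one_div_le_one_div_of_le (by norm_num) hp2
  have q₀ := tsum_quadrant_add_tsum_quadrant hτ (shiftStar p 0) (1 / (p : ℝ), 1 - 2 / (p : ℝ))
    (by simp [shiftStar]) (by simp [shiftStar])
  have q₁ := tsum_quadrant_add_tsum_quadrant hτ (shiftStar p 1) (1, 1 / (p : ℝ))
    (by simp [shiftStar]) (by simp [shiftStar])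
  have q₂ := tsum_quadrant_add_tsum_quadrant hτ (shiftStar p 2) (1 - 1 / (p : ℝ), 1 / (p : ℝ))
    (by simp [shiftStar]) (by simp [shiftStar])
  have s₀ : ∑' n, ((intSign n.1 * intSign n.2 : ℝ) : ℂ) * qForm τ (shiftStar p 0) n =
      falseTheta τ (shiftStar p 0) := by
    rcases hp.eq_or_lt with rfl | hlt
    · have : shiftStar 2 0 = (1 / 2, 1) := by
        simp only [shiftStar, Matrix.cons_val_zero]; norm_num
      rw [this]
      exact tsum_intSign_eq_falseTheta_half hτ
    · have hlt' : (2 : ℝ) < p := by exact_mod_cast hlt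
      refine tsum_intSign_eq_falseTheta ?_ ?_ ?_ ?_ <;>
        simp only [shiftStar, Matrix.cons_val_zero]
      · linarith
      · linarith
      · positivity
      · rwa [div_lt_one hp0]
  have s₁ := tsum_intSign_eq_falseTheta_add hτ (b := 1 - 1 / (p : ℝ)) (by linarith) (by linarith)
  have s₂ : ∑' n, ((intSign n.1 * intSign n.2 : ℝ) : ℂ) * qForm τ (shiftStar p 2) n =
      falseTheta τ (shiftStar p 2) := by
    refine tsum_intSign_eq_falseTheta ?_ ?_ ?_ ?_ <;> simp only [shiftStar] <;> simp <;>
      simp only [one_div] at hinv0 hinv1 <;> linarith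
  rw [show ((0 : ℝ), 1 - 1 / (p : ℝ)) = shiftStar p 1 from rfl, sub_sub_cancel] at s₁
  rw [s₀, tsum_qForm_shiftStar_zero] at q₀
  rw [s₁, tsum_qForm_shiftStar_one] at q₁
  rw [s₂] at q₂
  rw [F1, Fin.sum_univ_six, Fin.sum_univ_three]
  simp only [shiftStar] at q₀ q₁ q₂ ⊢
  simp only [shift, shiftWeight, shiftStarWeight]
  simp only [Fin.isValue, Matrix.cons_val] at q₀ q₁ q₂ ⊢
  linear_combination (-2) * q₀ + q₁ + q₂

/-! ### Both functions as Eichler integrals -/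

/-- The sum of the two theta series, restricted to `(x + i y₁, x + i y₂)`, times `√3`. -/
noncomputable def thetaSum (α : ℝ × ℝ) (x y₁ y₂ : ℝ) : ℂ :=
  thetaSeries orthoCoord₁ α x y₁ y₂ + thetaSeries orthoCoord₂ α x y₁ y₂

lemma exists_shiftStar_eq_div {p : ℕ} (hp : 0 < p) (j : Fin 3) :
    ∃ a₁ a₂ : ℤ, (shiftStar p j).1 = a₁ / p ∧ (shiftStar p j).2 = a₂ / p := by
  have hp' : (p : ℝ) ≠ 0 := by positivity
  fin_cases j
  · refine ⟨p - 1, 2, ?_, ?_⟩ <;> simp [shiftStar]; field_simp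
  · refine ⟨0, p - 1, ?_, ?_⟩ <;> simp [shiftStar]; field_simp
  · refine ⟨1, p - 1, ?_, ?_⟩ <;> simp [shiftStar]; field_simp

lemma isFlat_thetaSum {p : ℕ} (hp : 0 < p) (j : Fin 3) (h : ℤ) {k : ℕ} (hk : 0 < k) :
    IsFlat (thetaSum (shiftStar p j) (h / k)) := by
  obtain ⟨a₁, a₂, h₁, h₂⟩ := exists_shiftStar_eq_div hp j
  exact (isFlat_thetaSeries₁ hp h₁ h₂ h hk).add (isFlat_thetaSeries₂ hp h₁ h₂ h hk)

lemma one_div_add_intCast_ne_zero {p : ℕ} (hp : 2 ≤ p) (m : ℤ) : 1 / (p : ℝ) + m ≠ 0 := by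
  have hp2 : (2 : ℝ) ≤ p := by exact_mod_cast hp
  have hinv0 : 0 < 1 / (p : ℝ) := by positivity
  have hinv1 : 1 / (p : ℝ) ≤ 1 / 2 := one_div_le_one_div_of_le (by norm_num) hp2
  intro h
  have h1 : (-1 : ℝ) < m := by linarith
  have h2 : (m : ℝ) < 0 := by linarith
  have : -1 < m := by exact_mod_cast h1
  have : m < 0 := by exact_mod_cast h2
  omega

lemma shiftStar_add_ne_zero {p : ℕ} (hp : 2 ≤ p) (j : Fin 3) (n : ℤ × ℤ) :
    (shiftStar p j).1 + n.1 ≠ 0 ∨ (shiftStar p j).2 + n.2 ≠ 0 := by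
  fin_cases j
  · left
    have := one_div_add_intCast_ne_zero hp (-1 - n.1)
    intro h
    refine this ?_
    simp [shiftStar] at h ⊢
    linarith
  · right
    have := one_div_add_intCast_ne_zero hp (-1 - n.2)
    intro h
    refine this ?_
    simp [shiftStar] at h ⊢
    linarith
  · left
    exact one_div_add_intCast_ne_zero hp n.1

lemma nearRational_im (h k : ℤ) (t : ℝ) : (nearRational h k t).im = t / (2 * Real.pi) := by
  have : nearRational h k t = ((h / k : ℝ) : ℂ) + ((t / (2 * Real.pi) : ℝ) : ℂ) * Complex.I := by
    rw [nearRational]; push_cast; ring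
  rw [this, Complex.add_im, Complex.ofReal_im, zero_add, Complex.im_ofReal_mul, Complex.I_im, mul_one]

lemma qpow_nearRational (h k : ℤ) (t r : ℝ) : qpow (nearRational h k t) r =
    qpow (h / k : ℝ) r * (Real.exp (-(2 * Real.pi * (t / (2 * Real.pi))) * r) : ℂ) := by
  have hπ : (Real.pi : ℂ) ≠ 0 := by exact_mod_cast Real.pi_ne_zero
  rw [qpow, qpow, nearRational, Complex.ofReal_exp, ← Complex.exp_add]
  congr 1
  push_cast
  field_simp
  linear_combination (t * r : ℂ) * Complex.I_sq

/-- The false theta series as an Eichler integral. The second summand comes from the constant part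
of the sum of the two angles. -/
lemma falseTheta_eq {p : ℕ} (hp : 2 ≤ p) (j : Fin 3) (h : ℤ) {k : ℕ} (hk : 0 < k) {t : ℝ}
    (ht : 0 < t) :
    1 / 2 * falseTheta (nearRational h k t) (shiftStar p j) =
      1 / 4 * eichlerIntegral (thetaSum (shiftStar p j) (h / k)) (t / (2 * Real.pi)) -
        1 / 3 * ∑' n, qForm (nearRational h k t) (shiftStar p j) n := by
  have hπ := Real.pi_pos
  have hπ' : (Real.pi : ℂ) ≠ 0 := by exact_mod_cast Real.pi_ne_zero
  have hε : 0 < t / (2 * Real.pi) := by positivity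
  set α := shiftStar p j with hα
  set τ := nearRational h k t with hτ
  have hτ0 : 0 < τ.im := by rw [hτ, nearRational_im]; exact hε
  have hadd : eichlerIntegral (thetaSum α (h / k)) (t / (2 * Real.pi)) =
      eichlerIntegral (thetaSeries orthoCoord₁ α (h / k)) (t / (2 * Real.pi)) +
        eichlerIntegral (thetaSeries orthoCoord₂ α (h / k)) (t / (2 * Real.pi)) := by
    obtain ⟨a₁, a₂, h₁, h₂⟩ := exists_shiftStar_eq_div (by omega : 0 < p) j
    exact eichlerIntegral_add (isFlat_thetaSeries₁ (by omega) h₁ h₂ h hk)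
      (isFlat_thetaSeries₂ (by omega) h₁ h₂ h hk) _
  have h1 := hasSum_eichlerIntegral_thetaSeries orthoCoord₁_sq α (h / k) hε
  have h2 := hasSum_eichlerIntegral_thetaSeries orthoCoord₂_sq α (h / k) hε
  have h12 := h1.add h2
  have hs := summable_mul_qForm hτ0 α fun n : ℤ × ℤ => abs_sign_mul_le (α.1 + n.1) (α.2 + n.2)
  have hrhs := (hs.hasSum.mul_left 2).add ((summable_qForm hτ0 α).hasSum.mul_left (4 / 3))
  have key := h12.unique (hrhs.congr_fun fun n => ?_)
  · rw [hadd, key, falseTheta]; ring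
  · have ha := arctan_add_arctan_eq (shiftStar_add_ne_zero hp j n)
    rw [← hα] at ha
    rw [qForm, qpow_nearRational, ← mul_add, ← Complex.ofReal_add, ← mul_add, ← mul_add, ha]
    push_cast
    field_simp
    ring

/-- The sum of the weights vanishes and the three theta series agree, so that only the Eichler
integrals remain. -/
lemma F1_nearRational {p : ℕ} (hp : 2 ≤ p) (h : ℤ) {k : ℕ} (hk : 0 < k) {t : ℝ} (ht : 0 < t) :
    F1 p (nearRational h k t) = ∑ j, shiftStarWeight j *
      (1 / 4 * eichlerIntegral (thetaSum (shiftStar p j) (h / k)) (t / (2 * Real.pi))) := by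
  have hπ := Real.pi_pos
  rw [F1_eq_sum_falseTheta hp (by rw [nearRational_im]; positivity)]
  simp only [falseTheta_eq hp _ h hk ht, Fin.sum_univ_three, tsum_qForm_shiftStar_zero,
    tsum_qForm_shiftStar_one]
  simp only [shiftStarWeight, Matrix.cons_val]
  ring

lemma rootFactor_eq {τ w : ℂ} {r : ℝ} (hr : 0 ≤ r) (h : w + τ = r * Complex.I) :
    rootFactor τ w = (√r : ℂ) := by
  rw [rootFactor, h, show -Complex.I * (r * Complex.I) = r by
    linear_combination (-(r : ℂ)) * Complex.I_sq, Real.sqrt_eq_rpow, Complex.ofReal_cpow hr]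
  norm_num

/-- Fubini, and a translation in the outer variable. -/
lemma eichlerIntegral_neg_eq {G : ℝ → ℝ → ℂ} (hG : IsFlat G) {ε : ℝ} (hε : 0 < ε) :
    eichlerIntegral G (-ε) = ∫ s₁ in Ioi (0 : ℝ), ∫ s₂ in Ioi (0 : ℝ),
      G (ε + s₁) (ε + s₁ + s₂) / ((√(2 * ε + s₁) : ℂ) * (√(2 * ε + s₁ + s₂) : ℂ)) := by
  have hint := hG.integrableOn_mul_eichlerKernel (-ε)
  rw [eichlerIntegral, Measure.volume_eq_prod] at *
  rw [setIntegral_prod _ hint]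
  have hsub : ∫ u in Ioi (0 : ℝ), ∫ v in Ioi (0 : ℝ),
      G u (u + v) * (eichlerKernel (-ε) u (u + v) : ℂ) =
      ∫ u in Ioi ε, ∫ v in Ioi (0 : ℝ), G u (u + v) * (eichlerKernel (-ε) u (u + v) : ℂ) := by
    refine setIntegral_eq_of_subset_of_forall_sdiff_eq_zero measurableSet_Ioi
      (Ioi_subset_Ioi hε.le) fun u hu => ?_
    have : ¬ |-ε| < u := by rw [abs_neg, abs_of_pos hε]; exact hu.2
    simp only [eichlerKernel, if_neg this, Complex.ofReal_zero, mul_zero, integral_zero]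
  have hshift := (measurePreserving_add_left volume ε).setIntegral_preimage_emb
    (measurableEmbedding_addLeft ε)
    (fun u => ∫ v in Ioi (0 : ℝ), G u (u + v) * (eichlerKernel (-ε) u (u + v) : ℂ)) (Ioi ε)
  have hpre : (fun u : ℝ => ε + u) ⁻¹' Ioi ε = Ioi 0 := by ext; simp
  rw [hsub, ← hshift, hpre]
  refine setIntegral_congr_fun measurableSet_Ioi fun u hu => ?_
  have hu : 0 < u := hu
  refine integral_congr_ae (Eventually.of_forall fun v => ?_)
  simp only [eichlerKernel]
  rw [if_pos (by rw [abs_neg, abs_of_pos hε]; linarith), sub_neg_eq_add, sub_neg_eq_add,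
    show ε + u + ε = 2 * ε + u by ring, show ε + u + v + ε = 2 * ε + u + v by ring]
  push_cast
  rw [one_div_mul_one_div, div_eq_mul_one_div (G _ _)]

lemma bbE1_nearRational {p : ℕ} (hp : 2 ≤ p) (h : ℤ) {k : ℕ} (hk : 0 < k) {t : ℝ} (ht : 0 < t) :
    bbE1 p (nearRational h k t) = ∑ j, shiftStarWeight j *
      (1 / 4 * eichlerIntegral (thetaSum (shiftStar p j) ((-h : ℤ) / k)) (-(t / (2 * Real.pi)))) := by
  have hπ := Real.pi_pos
  have hp0 : (p : ℂ) ≠ 0 := by exact_mod_cast (by omega : p ≠ 0)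
  have hε : 0 < t / (2 * Real.pi) := by positivity
  rw [bbE1, calE1, mul_div_cancel₀ _ hp0]
  refine Finset.sum_congr rfl fun j _ => ?_
  congr 1
  rw [eichlerIntegral_neg_eq (isFlat_thetaSum (by omega) j (-h) hk) hε]
  set α := shiftStar p j
  set ε := t / (2 * Real.pi) with hεdef
  set x : ℝ := (-h : ℤ) / k with hx
  have hτ : nearRational h k t = -(x : ℂ) + ε * Complex.I := by
    rw [nearRational, hx, hεdef]; push_cast; ring
  have hz : -(starRingEnd ℂ) (nearRational h k t) = x + ε * Complex.I := by
    rw [hτ]; simp; ring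
  have hsqrt : ((√3 : ℝ) : ℂ) ≠ 0 := by
    exact_mod_cast (Real.sqrt_pos.2 (by norm_num : (0 : ℝ) < 3)).ne'
  rw [calE1Shift, hz, rayIntegral]
  have hin : ∀ s₁ ∈ Ioi (0 : ℝ), rayIntegral (fun w₂ =>
      (theta1 α (x + ε * Complex.I + s₁ * Complex.I) w₂ +
        theta2 α (x + ε * Complex.I + s₁ * Complex.I) w₂) /
        (rootFactor (nearRational h k t) (x + ε * Complex.I + s₁ * Complex.I) *
          rootFactor (nearRational h k t) w₂)) (x + ε * Complex.I + s₁ * Complex.I) * Complex.I =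
      -(1 / (√3 : ℂ)) * ∫ s₂ in Ioi (0 : ℝ), thetaSum α x (ε + s₁) (ε + s₁ + s₂) /
        ((√(2 * ε + s₁) : ℂ) * (√(2 * ε + s₁ + s₂) : ℂ)) := by
    intro s₁ hs₁
    have hs₁ : 0 < s₁ := hs₁
    rw [rayIntegral, ← integral_mul_const, ← integral_const_mul]
    refine setIntegral_congr_fun measurableSet_Ioi fun s₂ hs₂ => ?_
    have hs₂ : 0 < s₂ := hs₂
    have e₁ : (x : ℂ) + ε * Complex.I + s₁ * Complex.I = x + (ε + s₁ : ℝ) * Complex.I := by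
      push_cast; ring
    have e₂ : (x : ℂ) + ε * Complex.I + s₁ * Complex.I + s₂ * Complex.I =
        x + (ε + s₁ + s₂ : ℝ) * Complex.I := by
      push_cast; ring
    have r₁ : rootFactor (nearRational h k t) (x + (ε + s₁ : ℝ) * Complex.I) =
        (√(2 * ε + s₁) : ℂ) :=
      rootFactor_eq (by positivity) (by rw [hτ]; push_cast; ring)
    have r₂ : rootFactor (nearRational h k t) (x + (ε + s₁ + s₂ : ℝ) * Complex.I) =
        (√(2 * ε + s₁ + s₂) : ℂ) :=
      rootFactor_eq (by positivity) (by rw [hτ]; push_cast; ring)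
    simp only [e₂]
    rw [e₁, r₁, r₂, thetaSum, ← sqrt_three_mul_theta1, ← sqrt_three_mul_theta2]
    have hI := Complex.I_sq
    field_simp
    rw [hI]
    ring
  rw [setIntegral_congr_fun measurableSet_Ioi hin, integral_const_mul]
  field_simp

/-- Transfer of the expansion of Eichler integrals to `s = σ t`. -/
lemma hasAsympExpansion_of_eichlerIntegral {f : ℝ → ℂ} {G : Fin 3 → ℝ → ℝ → ℂ}
    (hG : ∀ j, IsFlat (G j)) (c : Fin 3 → ℂ) (σ : ℝ)
    (hf : ∀ t > 0, f t = ∑ j, c j * eichlerIntegral (G j) (σ * t)) :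
    HasAsympExpansion f fun m => σ ^ m * ∑ j, c j * eichlerIntegralCoeff (G j) m := by
  intro N
  choose C hC using fun j => (hG j).norm_eichlerIntegral_sub_le N
  refine Asymptotics.IsBigO.of_bound (∑ j, ‖c j‖ * (C j * |σ| ^ N)) ?_
  filter_upwards [self_mem_nhdsWithin] with t ht
  have ht : 0 < t := ht
  have e : f t - ∑ m ∈ Finset.range N, (σ : ℂ) ^ m *
      (∑ j, c j * eichlerIntegralCoeff (G j) m) * (t : ℂ) ^ m =
      ∑ j, c j * (eichlerIntegral (G j) (σ * t) -
        ∑ m ∈ Finset.range N, eichlerIntegralCoeff (G j) m * ((σ * t : ℝ) : ℂ) ^ m) := by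
    simp_rw [hf t ht, mul_sub, Finset.sum_sub_distrib, Finset.mul_sum, Finset.sum_mul]
    rw [Finset.sum_comm]
    congr 1
    refine Finset.sum_congr rfl fun j _ => Finset.sum_congr rfl fun m _ => ?_
    push_cast
    rw [mul_pow]
    ring
  rw [e, Finset.sum_mul]
  refine (norm_sum_le _ _).trans (Finset.sum_le_sum fun j _ => ?_)
  rw [norm_mul, mul_assoc, Real.norm_of_nonneg (by positivity : (0:ℝ) ≤ t ^ N)]
  refine mul_le_mul_of_nonneg_left ((hC j _).trans (le_of_eq ?_)) (norm_nonneg _)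
  rw [abs_mul, abs_of_pos ht, mul_pow, mul_assoc]

end RankTwoFalseTheta

theorem theorem7p1 (p : ℕ) (hp : 2 ≤ p) :
    ∃ a : ℤ → ℤ → ℕ → ℂ, ∀ h k : ℤ, 0 < k → IsCoprime h k →
      RankTwoFalseTheta.HasAsympExpansion
        (fun t : ℝ => RankTwoFalseTheta.F1 p (RankTwoFalseTheta.nearRational h k t))
        (fun m => a h k m) ∧
      RankTwoFalseTheta.HasAsympExpansion
        (fun t : ℝ => RankTwoFalseTheta.bbE1 p (RankTwoFalseTheta.nearRational h k t))
        (fun m => (-1) ^ m * a (-h) k m) := by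
  open RankTwoFalseTheta in
  refine ⟨fun h k m => ((1 / (2 * Real.pi) : ℝ) : ℂ) ^ m * ∑ j, shiftStarWeight j * (1 / 4) *
    eichlerIntegralCoeff (thetaSum (shiftStar p j) (h / k)) m, fun h k hk _ => ?_⟩
  lift k to ℕ using hk.le
  have hk : 0 < k := by exact_mod_cast hk
  have hp0 : 0 < p := by omega
  simp only [Int.cast_natCast]
  constructor
  · refine hasAsympExpansion_of_eichlerIntegral (fun j => isFlat_thetaSum hp0 j h hk)
      (fun j => shiftStarWeight j * (1 / 4)) (1 / (2 * Real.pi)) fun t ht => ?_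
    rw [F1_nearRational hp h hk ht]
    refine Finset.sum_congr rfl fun j _ => ?_
    rw [mul_assoc, one_div_mul_eq_div _ t]
  · have := hasAsympExpansion_of_eichlerIntegral (fun j => isFlat_thetaSum hp0 j (-h) hk)
      (fun j => shiftStarWeight j * (1 / 4)) (-(1 / (2 * Real.pi)))
      (f := fun t => bbE1 p (nearRational h k t)) fun t ht => by
        rw [bbE1_nearRational hp h hk ht]
        refine Finset.sum_congr rfl fun j _ => ?_
        rw [mul_assoc, neg_mul, one_div_mul_eq_div _ t]
    convert this using 2 with m
    rw [Complex.ofReal_neg, neg_pow _ m]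
    ring
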